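/- Let $m,n\ge 2$, and regard $\mathbb{C}^{m\times n}$ as a real vector space, of dimension $2mn$. Let $\mathcal{M}\subset\mathbb{C}^{m\times n}$ be the set of matrices with a repeated singular value, that is, the matrices for which two of the $\min(m,n)$ singular values (counted with multiplicity) coincide. Then $\mathcal{M}$ has real codimension $3$ in $\mathbb{C}^{m\times n}$, in the following sense: $\mathcal{M}$ is not empty, and it has a relatively open and dense subset $\mathcal{R}\subseteq\mathcal{M}$ such that $\mathcal{R}$ is an embedded smooth ($C^\infty$) real submanifold of $\mathbb{C}^{m\times n}$ of dimension $2mn-3$, and $\mathcal{M}\setminus\mathcal{R}$ is a finite union of embedded smooth real submanifolds of $\mathbb{C}^{m\times n}$ of dimensions smaller than $2mn-3$. -/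

import Mathlib

open scoped ContDiff

/- The vector space of complex matrices carries the entrywise sup norm. It is a finite-dimensional
real vector space, so its topology and its smooth structure do not depend on the norm. -/
attribute [local instance] Matrix.normedAddCommGroup Matrix.normedSpace

/-- `S` is an embedded smooth (`C^∞`) submanifold of dimension `d` of the real vector space `E`:
around each point of `S` there is a smooth chart of `E` (a `C^∞` diffeomorphism between open
subsets of `E`) that carries `S` onto a `d`-dimensional linear slice. -/
def IsSmoothSubmanifold {E : Type*} [NormedAddCommGroup E] [NormedSpace ℝ E]
    (d : ℕ) (S : Set E) : Prop :=
  ∀ x ∈ S, ∃ (φ : OpenPartialHomeomorph E E) (W : Submodule ℝ E),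
    x ∈ φ.source ∧
    ContDiffOn ℝ ∞ φ φ.source ∧
    ContDiffOn ℝ ∞ φ.symm φ.target ∧
    Module.finrank ℝ W = d ∧
    φ.source ∩ S = φ.source ∩ φ ⁻¹' (W : Set E)

/-- `S ⊆ E` has (real) codimension `c` in `E`, for sets that may have singular points: `S` is not
empty and, away from a singular part of larger codimension, it is an embedded smooth submanifold
`R` of dimension `dim E - c`. Precisely, `R` is open and dense in `S`, and the singular part
`S \ R` is a finite union of embedded smooth submanifolds of dimensions less than `dim R`.
If `S` is itself a nonempty submanifold of `E` of dimension `d`, then `R = S` is a valid choice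
and `c = dim E - d`. -/
def HasRealCodimension {E : Type*} [NormedAddCommGroup E] [NormedSpace ℝ E]
    (S : Set E) (c : ℕ) : Prop :=
  S.Nonempty ∧
  ∃ (d : ℕ) (R : Set E),
    d + c = Module.finrank ℝ E ∧
    IsSmoothSubmanifold d R ∧
    (∃ U : Set E, IsOpen U ∧ R = S ∩ U) ∧
    S ⊆ closure R ∧
    ∃ (k : ℕ) (T : Fin k → Set E) (e : Fin k → ℕ),
      S \ R = ⋃ i, T i ∧
      ∀ i, e i < d ∧ IsSmoothSubmanifold (e i) (T i)

/-- The `i`-th singular value of the complex `m × n` matrix `A`, counted from `0` and in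
nonincreasing order. The `m × n` matrix has `min m n` singular values, those with
`i < min m n`. -/
noncomputable def matrixSingularValue {m n : ℕ} (A : Matrix (Fin m) (Fin n) ℂ) (i : ℕ) : ℝ :=
  (Matrix.toEuclideanLin A).singularValues i

/-- The complex `m × n` matrices with a repeated singular value: two of the `min m n` singular
values, counted with multiplicity, coincide. -/
def repeatedSingularValueSet (m n : ℕ) : Set (Matrix (Fin m) (Fin n) ℂ) :=
  {A | ∃ i j : ℕ, i < j ∧ j < min m n ∧ matrixSingularValue A i = matrixSingularValue A j}

open Filter Topology Matrix

/-! The rank of `A` together with the multiplicities of the positive eigenvalues of `Aᴴ * A` cuts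
the space of matrices into finitely many strata. Near `A₀`, a matrix `A` lies in the stratum of
`A₀` exactly when `A` has the rank of `A₀` and, for each positive eigenvalue `μ` of `A₀ᴴ * A₀`, some
`x μ` near `μ` is an eigenvalue of `Aᴴ * A` of the same multiplicity. Each of these rank conditions
says that a Schur complement vanishes, and the resulting system of equations in `(A, x)` is a
submersion that is immersive in `x`, so the implicit function theorem makes each stratum a
submanifold. A multiplicity `k` costs `k ^ 2 - 1` real dimensions and a rank `ρ` costs
`2 * (m - ρ) * (n - ρ)`. Hence a single coincidence of positive singular values has codimension `3`,
and every other way to repeat a singular value has codimension at least `4`. Perturbing the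
singular value decomposition shows that the codimension `3` stratum is dense. -/

section SliceCharts

/-- The condition of `IsSmoothSubmanifold` at the single point `x`: some smooth chart around `x`
carries `S` onto a `d`-dimensional linear slice. -/
def HasSliceChartAt {E : Type*} [NormedAddCommGroup E] [NormedSpace ℝ E]
    (d : ℕ) (S : Set E) (x : E) : Prop :=
  ∃ (φ : OpenPartialHomeomorph E E) (W : Submodule ℝ E),
    x ∈ φ.source ∧
    ContDiffOn ℝ ∞ φ φ.source ∧
    ContDiffOn ℝ ∞ φ.symm φ.target ∧
    Module.finrank ℝ W = d ∧
    φ.source ∩ S = φ.source ∩ φ ⁻¹' (W : Set E)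

theorem eventually_exists_zero_near_iff {E P G : Type*} [PseudoMetricSpace E]
    [NormedAddCommGroup P] [NormedSpace ℝ P] [NormedAddCommGroup G] [NormedSpace ℝ G]
    {Φ : E × P → G} {x : E} {p : P} {S : Set E}
    {π : G →L[ℝ] P} {ψ : E → P} (hψ : ContinuousAt ψ x) (hψx : ψ x = p)
    (hψΦ : ∀ᶠ v in 𝓝 (x, p), π (Φ v) = 0 ↔ ψ v.1 = v.2)
    (hS : ∀ᶠ ε in 𝓝[>] (0 : ℝ), ∀ᶠ y in 𝓝 x, y ∈ S ↔ ∃ q, dist q p < ε ∧ Φ (y, q) = 0) :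
    ∀ᶠ y in 𝓝 x, y ∈ S ↔ Φ (y, ψ y) = 0 := by
  obtain ⟨ε₀, hε₀, hball⟩ := Metric.eventually_nhds_iff.mp hψΦ
  obtain ⟨ε, hSε, hε, hεε₀⟩ := (hS.and (Ioo_mem_nhdsGT hε₀)).exists
  have hψε : ∀ᶠ y in 𝓝 x, dist (ψ y) p < ε :=
    hψx ▸ hψ.eventually (Metric.ball_mem_nhds (ψ x) hε)
  filter_upwards [hSε, hψε, Metric.ball_mem_nhds x hε] with y hy hψy hyx
  rw [hy]
  refine ⟨?_, fun h => ⟨ψ y, hψy, h⟩⟩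
  rintro ⟨q, hq, hq0⟩
  have hdist : dist (y, q) (x, p) < ε₀ := (max_lt hyx hq).trans hεε₀
  have hψq : ψ y = q := (hball hdist).mp (by simp [hq0])
  rwa [hψq]

variable {E P G : Type*} [NormedAddCommGroup E] [NormedSpace ℝ E]
  [NormedAddCommGroup P] [NormedSpace ℝ P] [NormedAddCommGroup G] [NormedSpace ℝ G]

theorem hasSliceChartAt_of_hasFDerivAt_equiv [CompleteSpace E] {f : E → E} {f' : E ≃L[ℝ] E} {x : E}
    {S : Set E} {W : Submodule ℝ E} (hf : ContDiffAt ℝ ω f x)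
    (hf' : HasFDerivAt f (f' : E →L[ℝ] E) x) (hS : ∀ᶠ y in 𝓝 x, y ∈ S ↔ f y ∈ W) :
    HasSliceChartAt (Module.finrank ℝ W) S x := by
  have hω : (ω : WithTop ℕ∞) ≠ 0 := by simp
  set φ := hf.toOpenPartialHomeomorph f hf' hω
  have hx : x ∈ φ.source := hf.mem_toOpenPartialHomeomorph_source hf' hω
  have hsymm : ContDiffAt ℝ ω φ.symm (φ x) :=
    φ.contDiffAt_symm (φ.map_source hx) (by rwa [φ.left_inv hx]) (by rwa [φ.left_inv hx])
  have hfev : ∀ᶠ y in 𝓝 x, ContDiffAt ℝ ω f y := hf.eventually (by simp)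
  have hsymmev : ∀ᶠ y in 𝓝 x, ContDiffAt ℝ ω φ.symm (φ y) :=
    (φ.continuousAt hx).eventually (hsymm.eventually (by simp))
  obtain ⟨O, hO, hOopen, hxO⟩ := eventually_nhds_iff.mp (hfev.and (hsymmev.and hS))
  refine ⟨φ.restrOpen O hOopen, W, ⟨hx, hxO⟩, fun y hy => ?_, fun z hz => ?_, rfl, ?_⟩
  · exact ((hO y hy.2).1.of_le (by simp)).contDiffWithinAt
  · obtain ⟨hz₁, hz₂⟩ : z ∈ φ.target ∩ φ.symm ⁻¹' O := by simpa using hz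
    have h := (hO _ hz₂).2.1
    rw [φ.right_inv hz₁] at h
    exact (h.of_le (by simp)).contDiffWithinAt
  · ext y
    exact and_congr_right fun hy => (hO y hy.2).2.2

theorem exists_implicit_parametrization [CompleteSpace E] [CompleteSpace P] {Φ : E × P → G}
    {x : E} {p : P} {π : G →L[ℝ] P}
    (hΦ : ContDiffAt ℝ ω Φ (x, p)) (h0 : Φ (x, p) = 0)
    (hπ : ∀ q, π (fderiv ℝ Φ (x, p) (0, q)) = q) :
    ∃ ψ : E → P, ContDiffAt ℝ ω ψ x ∧ ψ x = p ∧ (∀ᶠ y in 𝓝 x, π (Φ (y, ψ y)) = 0) ∧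
      ∀ᶠ v in 𝓝 (x, p), π (Φ v) = 0 ↔ ψ v.1 = v.2 := by
  have hω : (ω : WithTop ℕ∞) ≠ 0 := by simp
  have hf : ContDiffAt ℝ ω (fun z => π (Φ z)) (x, p) := by fun_prop
  have hfderiv : fderiv ℝ (fun z => π (Φ z)) (x, p) = π.comp (fderiv ℝ Φ (x, p)) :=
    (π.hasFDerivAt.comp _ (hΦ.differentiableAt hω).hasFDerivAt).fderiv
  have hinv : (fderiv ℝ (fun z => π (Φ z)) (x, p) ∘L .inr ℝ E P).IsInvertible := by
    refine ⟨ContinuousLinearEquiv.refl ℝ P, ?_⟩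
    ext q
    simp [hfderiv, hπ]
  refine ⟨hf.implicitFunction hω hinv, hf.contDiffAt_implicitFunction hω hinv,
    hf.implicitFunction_apply_self hω hinv, ?_, ?_⟩
  · simpa [h0] using hf.eventually_apply_implicitFunction hω hinv
  · simpa [h0] using hf.eventually_apply_eq_iff_implicitFunction hω hinv

variable [FiniteDimensional ℝ E] [FiniteDimensional ℝ G]

theorem hasSliceChartAt_of_submersion {F : E → G} {x : E} {S : Set E} {d : ℕ}
    (hF : ContDiffAt ℝ ω F x) (hsurj : Function.Surjective (fderiv ℝ F x))
    (hS : ∀ᶠ y in 𝓝 x, y ∈ S ↔ F y = 0)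
    (hd : d + Module.finrank ℝ G = Module.finrank ℝ E) :
    HasSliceChartAt d S x := by
  set L := fderiv ℝ F x
  have hrange : L.range = ⊤ := LinearMap.range_eq_top.mpr hsurj
  obtain ⟨R, hR⟩ := L.exists_rightInverse_of_surjective hrange
  have hLR (g : G) : L (R g) = g := congr($hR g)
  -- Replacing the component of `y` along `range R` by that of `F y` straightens `F` to `L`.
  let f : E → E := fun y => y - R (L y) + R (F y)
  have hLf (y : E) : L (f y) = F y := by simp [f, hLR]
  have hf : ContDiffAt ℝ ω f x := by fun_prop
  have hf' : HasFDerivAt f (ContinuousLinearEquiv.refl ℝ E : E →L[ℝ] E) x := by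
    have hFx : HasFDerivAt F L x := (hF.differentiableAt (by simp)).hasFDerivAt
    refine (((hasFDerivAt_id x).sub (R.comp L).hasFDerivAt).add
      (R.hasFDerivAt.comp x hFx)).congr_fderiv ?_
    ext v
    simp
  have hker : Module.finrank ℝ L.ker = d := by
    have h := L.toLinearMap.finrank_range_add_finrank_ker
    rw [hrange, finrank_top] at h
    omega
  rw [← hker]
  refine hasSliceChartAt_of_hasFDerivAt_equiv hf hf' ?_
  filter_upwards [hS] with y hy
  rw [hy, LinearMap.mem_ker, ContinuousLinearMap.coe_coe, hLf]

theorem hasSliceChartAt_of_parametric_submersion [FiniteDimensional ℝ P] {Φ : E × P → G} {x : E}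
    {p : P} {S : Set E} {d : ℕ} (hΦ : ContDiffAt ℝ ω Φ (x, p)) (h0 : Φ (x, p) = 0)
    (hsurj : Function.Surjective (fderiv ℝ Φ (x, p)))
    (hinj : ∀ q : P, fderiv ℝ Φ (x, p) (0, q) = 0 → q = 0)
    (hS : ∀ᶠ ε in 𝓝[>] (0 : ℝ), ∀ᶠ y in 𝓝 x, y ∈ S ↔ ∃ q, dist q p < ε ∧ Φ (y, q) = 0)
    (hd : d + Module.finrank ℝ G = Module.finrank ℝ E + Module.finrank ℝ P) :
    HasSliceChartAt d S x := by
  set L := fderiv ℝ Φ (x, p)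
  let L₂ : P →L[ℝ] G := L.comp (.inr ℝ E P)
  obtain ⟨π₀, hπ₀⟩ := L₂.toLinearMap.exists_leftInverse_of_injective
    (LinearMap.ker_eq_bot'.mpr fun q hq => hinj q (by simpa [L₂] using hq))
  let π : G →L[ℝ] P := π₀.toContinuousLinearMap
  have hπ (q : P) : π (L₂ q) = q := congr($hπ₀ q)
  obtain ⟨ψ, hψ, rfl, hψ0, hψΦ⟩ := exists_implicit_parametrization hΦ h0 hπ
  -- The equation `π (Φ (y, q)) = 0` determines `q = ψ y`; the component of `Φ (y, ψ y)` in
  -- `ker π` is what remains of the system.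
  let Q := π.projKerOfRightInverse L₂ hπ
  let F : E → π.ker := fun y => Q (Φ (y, ψ y))
  have hF : ContDiffAt ℝ ω F x := by fun_prop
  have hψ' := (hψ.differentiableAt (by simp)).hasFDerivAt
  have hF' : fderiv ℝ F x = Q.comp (L.comp ((ContinuousLinearMap.id ℝ E).prod (fderiv ℝ ψ x))) :=
    (Q.hasFDerivAt.comp x ((hΦ.differentiableAt (by simp)).hasFDerivAt.comp x
      ((hasFDerivAt_id x).prodMk hψ'))).fderiv
  refine hasSliceChartAt_of_submersion hF (fun g => ?_) ?_ ?_
  · obtain ⟨⟨v, q⟩, hvq⟩ := hsurj g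
    have hsplit : L (v, fderiv ℝ ψ x v) = g + L₂ (fderiv ℝ ψ x v - q) := by
      rw [← hvq, ContinuousLinearMap.comp_apply, ContinuousLinearMap.inr_apply, ← map_add]
      simp
    exact ⟨v, by simp [hF', hsplit, Q]⟩
  · filter_upwards [eventually_exists_zero_near_iff hψ.continuousAt rfl hψΦ hS, hψ0] with y hy hy0
    have hFy : (F y : G) = Φ (y, ψ y) := by simp [F, Q, hy0]
    rw [hy, ← hFy, ZeroMemClass.coe_eq_zero]
  · have h := π.toLinearMap.finrank_range_add_finrank_ker
    rw [LinearMap.range_eq_top.mpr fun q => ⟨L₂ q, hπ q⟩, finrank_top] at h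
    omega

end SliceCharts

section MatrixCalculus

variable {m n k : Type*}
  {𝕜 : Type*} [NontriviallyNormedField 𝕜] {E : Type*} [NormedAddCommGroup E] [NormedSpace 𝕜 E]
  {r : WithTop ℕ∞} {x : E}

section Entries

variable {F : Type*} [NormedAddCommGroup F] [NormedSpace 𝕜 F] {f : E → Matrix m n F}

theorem contDiff_matrix [Fintype m] [Fintype n] :
    ContDiff 𝕜 r f ↔ ∀ i j, ContDiff 𝕜 r fun y => f y i j :=
  (contDiff_pi (Φ := f)).trans (forall_congr' fun _ => contDiff_pi)

variable [Finite n]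

theorem differentiableAt_matrix [Finite m] :
    DifferentiableAt 𝕜 f x ↔ ∀ i j, DifferentiableAt 𝕜 (fun y => f y i j) x := by
  have := Fintype.ofFinite n
  have := Fintype.ofFinite m
  exact (differentiableAt_pi (Φ := f)).trans (forall_congr' fun _ => differentiableAt_pi)

theorem fderiv_matrix_apply (hf : DifferentiableAt 𝕜 f x) (v : E) (i : m) (j : n) :
    fderiv 𝕜 f x v i j = fderiv 𝕜 (fun y => f y i j) x v := by
  have := Fintype.ofFinite n
  have hrow : HasFDerivAt (fun y => f y i) ((ContinuousLinearMap.proj i).comp (fderiv 𝕜 f x)) x :=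
    hasFDerivAt_pi'.mp hf.hasFDerivAt i
  exact congr($((hasFDerivAt_pi'.mp hrow j).fderiv.symm) v)

end Entries

section Star

variable {F : Type*} [NormedAddCommGroup F] [NormedSpace 𝕜 F] [StarRing 𝕜] [TrivialStar 𝕜]
  [StarAddMonoid F] [StarModule 𝕜 F] [ContinuousStar F] {f : E → Matrix m n F}

theorem contDiff_conjTranspose [Fintype m] [Fintype n] (hf : ContDiff 𝕜 r f) :
    ContDiff 𝕜 r fun y => (f y)ᴴ :=
  contDiff_matrix.mpr fun i j =>
    (starL' 𝕜 : F ≃L[𝕜] F).contDiff.comp (contDiff_matrix.mp hf j i)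

theorem fderiv_conjTranspose_apply [Finite m] [Finite n] (hf : DifferentiableAt 𝕜 f x) (v : E) :
    fderiv 𝕜 (fun y => (f y)ᴴ) x v = (fderiv 𝕜 f x v)ᴴ := by
  have hstar : DifferentiableAt 𝕜 (fun y => (f y)ᴴ) x :=
    differentiableAt_matrix.mpr fun i j => (differentiableAt_matrix.mp hf j i).star
  ext i j
  simp [fderiv_matrix_apply hstar, fderiv_matrix_apply hf]

end Star

section Mul

variable [Fintype n] {R : Type*} [NormedCommRing R] [NormedAlgebra 𝕜 R]
  {f : E → Matrix m n R} {g : E → Matrix n k R}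

theorem contDiff_matrix_mul [Fintype m] [Fintype k] (hf : ContDiff 𝕜 r f)
    (hg : ContDiff 𝕜 r g) : ContDiff 𝕜 r fun y => f y * g y :=
  contDiff_matrix.mpr fun i j => ContDiff.sum fun a _ =>
    (contDiff_matrix.mp hf i a).mul (contDiff_matrix.mp hg a j)

variable [Finite m] [Finite k]

theorem differentiableAt_matrix_mul (hf : DifferentiableAt 𝕜 f x) (hg : DifferentiableAt 𝕜 g x) :
    DifferentiableAt 𝕜 (fun y => f y * g y) x :=
  differentiableAt_matrix.mpr fun i j => DifferentiableAt.fun_sum fun a _ =>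
    (differentiableAt_matrix.mp hf i a).mul (differentiableAt_matrix.mp hg a j)

theorem fderiv_matrix_mul_apply (hf : DifferentiableAt 𝕜 f x) (hg : DifferentiableAt 𝕜 g x)
    (v : E) :
    fderiv 𝕜 (fun y => f y * g y) x v = f x * fderiv 𝕜 g x v + fderiv 𝕜 f x v * g x := by
  have hf' := differentiableAt_matrix.mp hf
  have hg' := differentiableAt_matrix.mp hg
  have hmul : DifferentiableAt 𝕜 (fun y => f y * g y) x := differentiableAt_matrix_mul hf hg
  ext i j
  have hentry : HasFDerivAt (fun y => (f y * g y) i j)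
      (∑ a, (f x i a • fderiv 𝕜 (fun y => g y a j) x + g x a j • fderiv 𝕜 (fun y => f y i a) x))
      x :=
    HasFDerivAt.fun_sum fun a _ => (hf' i a).hasFDerivAt.mul (hg' a j).hasFDerivAt
  calc fderiv 𝕜 (fun y => f y * g y) x v i j
      = fderiv 𝕜 (fun y => (f y * g y) i j) x v :=
        fderiv_matrix_apply hmul v i j
    _ = ∑ a, (f x i a * fderiv 𝕜 g x v a j + g x a j * fderiv 𝕜 f x v i a) := by
        simp [hentry.fderiv, fderiv_matrix_apply hf, fderiv_matrix_apply hg]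
    _ = (f x * fderiv 𝕜 g x v + fderiv 𝕜 f x v * g x) i j := by
        simp [Matrix.mul_apply, Finset.sum_add_distrib, mul_comm]

end Mul

section Det

variable [Fintype n] [DecidableEq n] {R : Type*} [NormedCommRing R] [NormedAlgebra 𝕜 R]
  {f : E → Matrix n n R}

theorem contDiff_matrix_det (hf : ContDiff 𝕜 r f) : ContDiff 𝕜 r fun y => (f y).det := by
  simp only [Matrix.det_apply']
  exact ContDiff.sum fun σ _ =>
    contDiff_const.mul (contDiff_prod fun i _ => contDiff_matrix.mp hf _ _)

theorem contDiff_matrix_adjugate (hf : ContDiff 𝕜 r f) : ContDiff 𝕜 r fun y => (f y).adjugate := by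
  refine contDiff_matrix.mpr fun i j => ?_
  simp only [Matrix.adjugate_apply]
  refine contDiff_matrix_det (contDiff_matrix.mpr fun a b => ?_)
  by_cases h : a = j
  · simpa [h] using contDiff_const
  · simpa [Matrix.updateRow_apply, h] using contDiff_matrix.mp hf a b

end Det

end MatrixCalculus

section RankOfKernel

variable {K m n k : Type*} [Field K] [Fintype n] [Fintype k] {X : Matrix m n K} {ι : Matrix n k K}

theorem ker_mulVecLin_le_range_of_mul_eq_one_sub [Fintype m] [DecidableEq n]
    {G : Matrix n m K} {κ : Matrix k n K} (hX : G * X = 1 - ι * κ) :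
    LinearMap.ker X.mulVecLin ≤ LinearMap.range ι.mulVecLin := by
  intro v (hv : X *ᵥ v = 0)
  have hv' : (1 - ι * κ) *ᵥ v = 0 := by rw [← hX, ← mulVec_mulVec, hv, mulVec_zero]
  rw [sub_mulVec, one_mulVec, sub_eq_zero, ← mulVec_mulVec] at hv'
  exact ⟨κ *ᵥ v, hv'.symm⟩

theorem rank_add_finrank_ker (X : Matrix m n K) :
    X.rank + Module.finrank K (LinearMap.ker X.mulVecLin) = Fintype.card n := by
  simpa [Matrix.rank] using X.mulVecLin.finrank_range_add_finrank_ker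

theorem card_le_rank_add_card_of_ker_le
    (hker : LinearMap.ker X.mulVecLin ≤ LinearMap.range ι.mulVecLin) :
    Fintype.card n ≤ X.rank + Fintype.card k := by
  rw [← rank_add_finrank_ker X]
  gcongr
  exact (Submodule.finrank_mono hker).trans (rank_le_card_width ι)

theorem rank_add_card_eq_iff_mul_eq_zero [Finite m] (hι : ι.rank = Fintype.card k)
    (hker : LinearMap.ker X.mulVecLin ≤ LinearMap.range ι.mulVecLin) :
    X.rank + Fintype.card k = Fintype.card n ↔ X * ι = 0 := by
  classical
  have := Fintype.ofFinite m
  have hι' : Module.finrank K (LinearMap.range ι.mulVecLin) = Fintype.card k := hι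
  refine ⟨fun h => ?_, fun h => ?_⟩
  · have hrank := rank_add_finrank_ker X
    have heq : LinearMap.ker X.mulVecLin = LinearMap.range ι.mulVecLin :=
      Submodule.eq_of_le_of_finrank_le hker (by lia)
    refine Matrix.ext_of_mulVec_single fun i => ?_
    have hmem : ι *ᵥ Pi.single i 1 ∈ LinearMap.ker X.mulVecLin := heq ▸ ⟨_, rfl⟩
    rw [← mulVec_mulVec, zero_mulVec]
    exact hmem
  · have hle := rank_add_rank_le_card_of_mul_eq_zero h
    have hge := card_le_rank_add_card_of_ker_le hker
    lia

end RankOfKernel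

section SchurComplement

variable {K m n k l : Type*} [Field K] [Fintype m] [Fintype n] [DecidableEq n]

/-- A Schur complement of `T + D`, where `G` is a generalized inverse of `T`, the columns of `ι`
span the kernel of `T` and the rows of `π` cut out its range. The inverse of `1 + G * D` is
replaced by its adjugate, so that the expression is polynomial in `D`. -/
def schurComplement (π : Matrix l m K) (G : Matrix n m K) (ι : Matrix n k K) (D : Matrix m n K) :
    Matrix l k K :=
  π * (D * (adjugate (1 + G * D) * ι))

/-- `G` inverts `T` up to the projection `ι * κ` onto the kernel of `T` and the projection `j * π`,
which annihilates the range of `T`. -/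
structure IsGeneralizedInverse [DecidableEq m] [Fintype k] [Fintype l] [DecidableEq k]
    (T : Matrix m n K) (G : Matrix n m K) (ι : Matrix n k K) (κ : Matrix k n K) (π : Matrix l m K)
    (j : Matrix m l K) : Prop where
  inv_mul : G * T = 1 - ι * κ
  mul_inv : T * G = 1 - j * π
  ker_coord_mul_inv : κ * G = 0
  ker_coord_mul_ker : κ * ι = 1
  coker_mul : π * T = 0

namespace IsGeneralizedInverse

variable [DecidableEq m] [Fintype k] [Fintype l] [DecidableEq k]
  {T D : Matrix m n K} {G : Matrix n m K} {ι : Matrix n k K} {κ : Matrix k n K}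
  {π : Matrix l m K} {j : Matrix m l K}

theorem inv_mul_add_mul_inv (h : IsGeneralizedInverse T G ι κ π j) (hdet : IsUnit (1 + G * D).det) :
    G * ((T + D) * (1 + G * D)⁻¹) = 1 - ι * κ := by
  have hκ : κ * (1 + G * D)⁻¹ = κ := by
    calc κ * (1 + G * D)⁻¹ = κ * (1 + G * D) * (1 + G * D)⁻¹ := by
          rw [Matrix.mul_add, Matrix.mul_one, ← Matrix.mul_assoc, h.ker_coord_mul_inv,
            Matrix.zero_mul, add_zero]
      _ = κ := mul_nonsing_inv_cancel_right _ _ hdet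
  calc G * ((T + D) * (1 + G * D)⁻¹) = (1 + G * D - ι * κ) * (1 + G * D)⁻¹ := by
        rw [← Matrix.mul_assoc, Matrix.mul_add, h.inv_mul, sub_add_eq_add_sub]
    _ = 1 - ι * κ := by
        rw [Matrix.sub_mul, mul_nonsing_inv _ hdet, Matrix.mul_assoc, hκ]

theorem det_smul_coker_mul (h : IsGeneralizedInverse T G ι κ π j) (hdet : (1 + G * D).det ≠ 0) :
    (1 + G * D).det • (π * ((T + D) * (1 + G * D)⁻¹ * ι)) = schurComplement π G ι D := by
  have hπ : π * (T + D) = π * D := by rw [Matrix.mul_add, h.coker_mul, zero_add]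
  rw [← Matrix.mul_assoc, ← Matrix.mul_assoc, hπ, Matrix.inv_def, Ring.inverse_eq_inv',
    Matrix.mul_smul, Matrix.smul_mul, smul_smul, mul_inv_cancel₀ hdet, one_smul]
  simp only [schurComplement, Matrix.mul_assoc]

theorem mul_ker_eq_zero_iff (h : IsGeneralizedInverse T G ι κ π j) (hdet : (1 + G * D).det ≠ 0) :
    (T + D) * (1 + G * D)⁻¹ * ι = 0 ↔ schurComplement π G ι D = 0 := by
  rw [← h.det_smul_coker_mul hdet, smul_eq_zero_iff_right hdet]
  refine ⟨fun hX => by rw [hX, Matrix.mul_zero], fun hX => ?_⟩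
  set X := (T + D) * (1 + G * D)⁻¹
  have hGX : G * (X * ι) = 0 := by
    rw [← Matrix.mul_assoc, h.inv_mul_add_mul_inv hdet.isUnit, Matrix.sub_mul, Matrix.one_mul,
      Matrix.mul_assoc, h.ker_coord_mul_ker, Matrix.mul_one, sub_self]
  calc X * ι = (1 - j * π) * (X * ι) := by
        rw [Matrix.sub_mul, Matrix.one_mul, Matrix.mul_assoc j, hX, Matrix.mul_zero, sub_zero]
    _ = 0 := by rw [← h.mul_inv, Matrix.mul_assoc, hGX, Matrix.mul_zero]

theorem card_le_rank_add_card (h : IsGeneralizedInverse T G ι κ π j)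
    (hdet : (1 + G * D).det ≠ 0) : Fintype.card n ≤ (T + D).rank + Fintype.card k := by
  rw [← rank_mul_eq_left_of_isUnit_det _ (T + D) (isUnit_nonsing_inv_det _ hdet.isUnit)]
  exact card_le_rank_add_card_of_ker_le
    (ker_mulVecLin_le_range_of_mul_eq_one_sub (h.inv_mul_add_mul_inv hdet.isUnit))

theorem rank_add_card_eq_iff_schurComplement_eq_zero (h : IsGeneralizedInverse T G ι κ π j)
    (hdet : (1 + G * D).det ≠ 0) :
    (T + D).rank + Fintype.card k = Fintype.card n ↔ schurComplement π G ι D = 0 := by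
  have hι : ι.rank = Fintype.card k := by
    refine le_antisymm (rank_le_card_width ι) ?_
    simpa [h.ker_coord_mul_ker] using rank_mul_le_right κ ι
  rw [← rank_mul_eq_left_of_isUnit_det _ (T + D) (isUnit_nonsing_inv_det _ hdet.isUnit),
    ← h.mul_ker_eq_zero_iff hdet]
  exact rank_add_card_eq_iff_mul_eq_zero hι
    (ker_mulVecLin_le_range_of_mul_eq_one_sub (h.inv_mul_add_mul_inv hdet.isUnit))

end IsGeneralizedInverse

theorem adjugate_one_add_mul_mul {G : Matrix n m K} {D : Matrix m n K} [DecidableEq m]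
    (hdet : (1 + G * D).det ≠ 0) :
    adjugate (1 + D * G) * D = D * adjugate (1 + G * D) := by
  have hcomm : (1 + D * G) * D = D * (1 + G * D) := by
    rw [Matrix.add_mul, Matrix.mul_add, Matrix.one_mul, Matrix.mul_one, Matrix.mul_assoc]
  refine smul_right_injective _ hdet ?_
  calc (1 + G * D).det • (adjugate (1 + D * G) * D)
      = adjugate (1 + D * G) * (D * (1 + G * D)) * adjugate (1 + G * D) := by
        simp only [Matrix.mul_assoc, mul_adjugate, Matrix.mul_smul, Matrix.mul_one]
    _ = adjugate (1 + D * G) * (1 + D * G) * D * adjugate (1 + G * D) := by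
        rw [← hcomm, Matrix.mul_assoc (adjugate _) _ D]
    _ = (1 + G * D).det • (D * adjugate (1 + G * D)) := by
        rw [adjugate_mul, det_one_add_mul_comm D G, Matrix.smul_mul, Matrix.one_mul,
          Matrix.smul_mul]

theorem isHermitian_schurComplement [StarRing K] {G D : Matrix n n K} (ι : Matrix n k K)
    (hG : G.IsHermitian) (hD : D.IsHermitian) (hdet : (1 + G * D).det ≠ 0) :
    (schurComplement ιᴴ G ι D).IsHermitian := by
  have hadj : (adjugate (1 + G * D))ᴴ = adjugate (1 + D * G) := by
    simp [adjugate_conjTranspose, conjTranspose_add, conjTranspose_mul, hG.eq, hD.eq]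
  simp only [Matrix.IsHermitian, schurComplement, conjTranspose_mul, hadj, hD.eq,
    conjTranspose_conjTranspose, Matrix.mul_assoc]
  rw [← Matrix.mul_assoc _ D, adjugate_one_add_mul_mul hdet, Matrix.mul_assoc]

section Calculus

variable {𝕜 R E : Type*} [NontriviallyNormedField 𝕜] [NormedField R] [NormedAlgebra 𝕜 R]
  [NormedAddCommGroup E] [NormedSpace 𝕜 E] {π : Matrix l m R} {G : Matrix n m R}
  {ι : Matrix n k R} {D : E → Matrix m n R}

theorem contDiff_schurComplement [Fintype k] [Fintype l] {r : WithTop ℕ∞} (hD : ContDiff 𝕜 r D) :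
    ContDiff 𝕜 r fun y => schurComplement π G ι (D y) :=
  contDiff_matrix_mul contDiff_const <| contDiff_matrix_mul hD <| contDiff_matrix_mul
    (contDiff_matrix_adjugate (contDiff_const.add (contDiff_matrix_mul contDiff_const hD)))
    contDiff_const

theorem fderiv_schurComplement_apply [Finite k] [Finite l] {x : E} (hD : DifferentiableAt 𝕜 D x)
    (hDx : D x = 0) (v : E) :
    fderiv 𝕜 (fun y => schurComplement π G ι (D y)) x v = π * (fderiv 𝕜 D x v * ι) := by
  have hGD : DifferentiableAt 𝕜 (fun y => 1 + G * D y) x :=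
    (differentiableAt_const _).add (differentiableAt_matrix_mul (differentiableAt_const G) hD)
  have hadj : DifferentiableAt 𝕜 (fun y => adjugate (1 + G * D y)) x :=
    ((contDiff_matrix_adjugate contDiff_id).differentiable one_ne_zero _).comp x hGD
  have hadjι := differentiableAt_matrix_mul hadj (differentiableAt_const ι)
  have hDadj := differentiableAt_matrix_mul hD hadjι
  simp only [schurComplement]
  rw [fderiv_matrix_mul_apply (differentiableAt_const π) hDadj, fderiv_matrix_mul_apply hD hadjι,
    hDx]
  simp

end Calculus

end SchurComplement

section Spectral

variable {𝕜 n : Type*} [RCLike 𝕜] [Fintype n] [DecidableEq n]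

/-- `H = V * diagonal d * Vᴴ` with `V` unitary and `d` real: the columns of `V` are an orthonormal
basis of eigenvectors of `H`, with eigenvalues `d`. -/
structure IsUnitaryDiagonalization (H V : Matrix n n 𝕜) (d : n → ℝ) : Prop where
  conjTranspose_mul_self : Vᴴ * V = 1
  eq_conj_diagonal : H = V * diagonal (fun j => (d j : 𝕜)) * Vᴴ

/-- The columns of `V` with `d j = μ`. When `V` and `d` diagonalize a matrix, they form an
orthonormal basis of its eigenspace for the eigenvalue `μ`. -/
def eigenColumns (V : Matrix n n 𝕜) (d : n → ℝ) (μ : ℝ) : Matrix n {j // d j = μ} 𝕜 :=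
  V.submatrix id Subtype.val

/-- The pseudoinverse of `V * diagonal d * Vᴴ - μ`, for unitary `V`; on the kernel, it vanishes
because `0⁻¹ = 0`. -/
noncomputable def shiftedPinv (V : Matrix n n 𝕜) (d : n → ℝ) (μ : ℝ) : Matrix n n 𝕜 :=
  V * diagonal (fun j => (((d j - μ)⁻¹ : ℝ) : 𝕜)) * Vᴴ

theorem conj_diagonal_mul_conj_diagonal {V : Matrix n n 𝕜} (hV : Vᴴ * V = 1) (x y : n → 𝕜) :
    V * diagonal x * Vᴴ * (V * diagonal y * Vᴴ) = V * diagonal (x * y) * Vᴴ := by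
  calc V * diagonal x * Vᴴ * (V * diagonal y * Vᴴ)
      = V * diagonal x * ((Vᴴ * V) * (diagonal y * Vᴴ)) := by simp only [Matrix.mul_assoc]
    _ = V * (diagonal x * diagonal y) * Vᴴ := by
        rw [hV, Matrix.one_mul, ← Matrix.mul_assoc, Matrix.mul_assoc V]
    _ = V * diagonal (x * y) * Vᴴ := by
        rw [diagonal_mul_diagonal]
        rfl

theorem isHermitian_conj_diagonal (V : Matrix n n 𝕜) (d : n → ℝ) :
    (V * diagonal (fun j => (d j : 𝕜)) * Vᴴ).IsHermitian :=
  isHermitian_mul_mul_conjTranspose V (isHermitian_diagonal_of_self_adjoint _ (by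
    ext j; simp))

theorem isHermitian_shiftedPinv (V : Matrix n n 𝕜) (d : n → ℝ) (μ : ℝ) :
    (shiftedPinv V d μ).IsHermitian :=
  isHermitian_conj_diagonal V _

theorem eigenColumns_mul_conjTranspose (V : Matrix n n 𝕜) (d : n → ℝ) (μ : ℝ) :
    eigenColumns V d μ * (eigenColumns V d μ)ᴴ
      = V * diagonal (fun j => if d j = μ then 1 else 0) * Vᴴ := by
  ext a b
  rw [Matrix.mul_apply, Matrix.mul_apply]
  simp only [Matrix.mul_diagonal, mul_ite, mul_one, mul_zero, ite_mul, zero_mul]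
  rw [← Finset.sum_filter]
  exact (Finset.sum_subtype (p := fun j => d j = μ) (Finset.univ.filter fun j => d j = μ)
    (by simp) (fun j => V a j * Vᴴ j b)).symm

namespace IsUnitaryDiagonalization

variable {H V : Matrix n n 𝕜} {d : n → ℝ}

theorem mul_conjTranspose_self (h : IsUnitaryDiagonalization H V d) : V * Vᴴ = 1 :=
  mul_eq_one_comm.mp h.conjTranspose_mul_self

theorem isHermitian (h : IsUnitaryDiagonalization H V d) : H.IsHermitian := by
  rw [h.eq_conj_diagonal]
  exact isHermitian_conj_diagonal V d

theorem sub_smul_one (h : IsUnitaryDiagonalization H V d) (μ : ℝ) :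
    IsUnitaryDiagonalization (H - (μ : 𝕜) • (1 : Matrix n n 𝕜)) V (fun j => d j - μ) := by
  refine ⟨h.conjTranspose_mul_self, ?_⟩
  have hdiag : diagonal (fun j => ((d j - μ : ℝ) : 𝕜))
      = diagonal (fun j => (d j : 𝕜)) - (μ : 𝕜) • (1 : Matrix n n 𝕜) := by
    rw [smul_one_eq_diagonal, diagonal_sub]
    simp only [RCLike.ofReal_sub]
  rw [hdiag, Matrix.mul_sub, Matrix.sub_mul, ← h.eq_conj_diagonal, Matrix.mul_smul,
    Matrix.smul_mul, Matrix.mul_one, h.mul_conjTranspose_self]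

theorem eigenColumns_conjTranspose_mul_apply (h : IsUnitaryDiagonalization H V d) (μ : ℝ)
    (a : {j // d j = μ}) (b : n) :
    ((eigenColumns V d μ)ᴴ * V) a b = if a.1 = b then 1 else 0 := by
  rw [← Matrix.one_apply, ← h.conjTranspose_mul_self]
  simp [eigenColumns, Matrix.mul_apply]

theorem eigenColumns_conjTranspose_mul_self (h : IsUnitaryDiagonalization H V d) (μ : ℝ) :
    (eigenColumns V d μ)ᴴ * eigenColumns V d μ = 1 := by
  ext a b
  simp only [Matrix.one_apply, Subtype.ext_iff]
  exact h.eigenColumns_conjTranspose_mul_apply μ a b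

theorem eigenColumns_conjTranspose_mul_of_ne (h : IsUnitaryDiagonalization H V d) {μ ν : ℝ}
    (hμν : μ ≠ ν) : (eigenColumns V d μ)ᴴ * eigenColumns V d ν = 0 := by
  ext a b
  have hab : a.1 ≠ b.1 := fun hab => hμν (by rw [← a.2, hab, b.2])
  exact (h.eigenColumns_conjTranspose_mul_apply μ a b).trans (if_neg hab)

theorem eigenColumns_conjTranspose_mul_conj_diagonal (h : IsUnitaryDiagonalization H V d) (μ : ℝ)
    {x : n → 𝕜} (hx : ∀ j, d j = μ → x j = 0) :
    (eigenColumns V d μ)ᴴ * (V * diagonal x * Vᴴ) = 0 := by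
  have hzero : (eigenColumns V d μ)ᴴ * V * diagonal x = 0 := by
    ext a b
    rw [Matrix.mul_diagonal, h.eigenColumns_conjTranspose_mul_apply]
    by_cases hab : a.1 = b
    · simp [hx b (hab ▸ a.2)]
    · simp [hab]
  rw [← Matrix.mul_assoc, ← Matrix.mul_assoc, hzero, Matrix.zero_mul]

theorem eigenColumns_conjTranspose_mul_shiftedPinv (h : IsUnitaryDiagonalization H V d) (μ : ℝ) :
    (eigenColumns V d μ)ᴴ * shiftedPinv V d μ = 0 :=
  h.eigenColumns_conjTranspose_mul_conj_diagonal μ fun j hj => by simp [hj]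

theorem eigenColumns_conjTranspose_mul_sub (h : IsUnitaryDiagonalization H V d) (μ : ℝ) :
    (eigenColumns V d μ)ᴴ * (H - (μ : 𝕜) • (1 : Matrix n n 𝕜)) = 0 := by
  rw [(h.sub_smul_one μ).eq_conj_diagonal]
  exact h.eigenColumns_conjTranspose_mul_conj_diagonal μ fun j hj => by simp [hj]

theorem shiftedPinv_mul_sub (h : IsUnitaryDiagonalization H V d) (μ : ℝ) :
    shiftedPinv V d μ * (H - (μ : 𝕜) • (1 : Matrix n n 𝕜))
      = 1 - eigenColumns V d μ * (eigenColumns V d μ)ᴴ := by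
  have hone : (1 : Matrix n n 𝕜) = V * diagonal 1 * Vᴴ := by simp [h.mul_conjTranspose_self]
  rw [(h.sub_smul_one μ).eq_conj_diagonal, shiftedPinv,
    conj_diagonal_mul_conj_diagonal h.conjTranspose_mul_self, eigenColumns_mul_conjTranspose, hone,
    ← Matrix.sub_mul, ← Matrix.mul_sub, diagonal_sub]
  congr 3
  funext j
  by_cases hj : d j = μ
  · simp [hj]
  · simp only [Pi.mul_apply, Pi.one_apply, hj, if_false, sub_zero]
    rw [← RCLike.ofReal_mul, inv_mul_cancel₀ (sub_ne_zero.mpr hj), RCLike.ofReal_one]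

theorem sub_mul_shiftedPinv (h : IsUnitaryDiagonalization H V d) (μ : ℝ) :
    (H - (μ : 𝕜) • (1 : Matrix n n 𝕜)) * shiftedPinv V d μ
      = 1 - eigenColumns V d μ * (eigenColumns V d μ)ᴴ := by
  rw [← h.shiftedPinv_mul_sub, (h.sub_smul_one μ).eq_conj_diagonal, shiftedPinv,
    conj_diagonal_mul_conj_diagonal h.conjTranspose_mul_self,
    conj_diagonal_mul_conj_diagonal h.conjTranspose_mul_self, mul_comm]

theorem isGeneralizedInverse_sub (h : IsUnitaryDiagonalization H V d) (μ : ℝ) :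
    IsGeneralizedInverse (H - (μ : 𝕜) • (1 : Matrix n n 𝕜)) (shiftedPinv V d μ)
      (eigenColumns V d μ) (eigenColumns V d μ)ᴴ (eigenColumns V d μ)ᴴ (eigenColumns V d μ) where
  inv_mul := h.shiftedPinv_mul_sub μ
  mul_inv := h.sub_mul_shiftedPinv μ
  ker_coord_mul_inv := h.eigenColumns_conjTranspose_mul_shiftedPinv μ
  ker_coord_mul_ker := h.eigenColumns_conjTranspose_mul_self μ
  coker_mul := h.eigenColumns_conjTranspose_mul_sub μ

theorem mul_eigenColumns (h : IsUnitaryDiagonalization H V d) (μ : ℝ) :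
    H * eigenColumns V d μ = (μ : 𝕜) • eigenColumns V d μ := by
  have hzero := congrArg conjTranspose (h.eigenColumns_conjTranspose_mul_sub μ)
  rw [conjTranspose_mul, conjTranspose_conjTranspose,
    ((h.sub_smul_one μ).isHermitian).eq, conjTranspose_zero, Matrix.sub_mul, Matrix.smul_mul,
    Matrix.one_mul, sub_eq_zero] at hzero
  exact hzero

theorem rank_sub_smul_one_add_card (h : IsUnitaryDiagonalization H V d) (μ : ℝ) :
    (H - (μ : 𝕜) • (1 : Matrix n n 𝕜)).rank + Fintype.card {j // d j = μ} = Fintype.card n := by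
  simpa using ((h.isGeneralizedInverse_sub μ).rank_add_card_eq_iff_schurComplement_eq_zero (D := 0)
    (by simp)).mpr (by simp [schurComplement])

theorem det_eq_prod (h : IsUnitaryDiagonalization H V d) : H.det = ∏ j, (d j : 𝕜) := by
  rw [h.eq_conj_diagonal, det_mul_right_comm, h.mul_conjTranspose_self, Matrix.one_mul,
    det_diagonal]

theorem exists_abs_lt_of_norm_det_lt (h : IsUnitaryDiagonalization H V d) {ε : ℝ} (hε : 0 ≤ ε)
    (hdet : ‖H.det‖ < ε ^ Fintype.card n) : ∃ j, |d j| < ε := by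
  by_contra! hle
  refine hdet.not_ge ?_
  rw [h.det_eq_prod, norm_prod]
  simp only [RCLike.norm_ofReal]
  calc ε ^ Fintype.card n = ∏ _j : n, ε := by simp
    _ ≤ ∏ j, |d j| := Finset.prod_le_prod (fun _ _ => hε) fun j _ => hle j

open scoped ComplexOrder in
theorem eigenColumns_zero_conjTranspose_mul {m : Type*} [Fintype m] {A : Matrix n m 𝕜}
    (h : IsUnitaryDiagonalization (A * Aᴴ) V d) : (eigenColumns V d 0)ᴴ * A = 0 := by
  rw [← mul_self_mul_conjTranspose_eq_zero]
  simpa using h.eigenColumns_conjTranspose_mul_sub 0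

section MulConjTranspose

variable {m : Type*} [Fintype m] [DecidableEq m] {A : Matrix m n 𝕜} {U : Matrix m m 𝕜} {e : m → ℝ}

theorem mul_shiftedPinv_zero_mul (hV : IsUnitaryDiagonalization (Aᴴ * A) V d)
    (hU : IsUnitaryDiagonalization (A * Aᴴ) U e) :
    A * (shiftedPinv V d 0 * Aᴴ) = 1 - eigenColumns U e 0 * (eigenColumns U e 0)ᴴ := by
  set P := A * (shiftedPinv V d 0 * Aᴴ)
  set j := eigenColumns U e 0
  have hker : (eigenColumns V d 0)ᴴ * Aᴴ = 0 :=
    eigenColumns_zero_conjTranspose_mul (by rwa [conjTranspose_conjTranspose])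
  have hAP : Aᴴ * P = Aᴴ := by
    have hproj : Aᴴ * A * shiftedPinv V d 0 = 1 - eigenColumns V d 0 * (eigenColumns V d 0)ᴴ := by
      simpa using hV.sub_mul_shiftedPinv 0
    calc Aᴴ * P = Aᴴ * A * shiftedPinv V d 0 * Aᴴ := by simp only [P, Matrix.mul_assoc]
      _ = Aᴴ := by
          rw [hproj, Matrix.sub_mul, Matrix.mul_assoc, hker, Matrix.mul_zero, Matrix.one_mul,
            sub_zero]
  have hjP : jᴴ * P = 0 := by
    rw [← Matrix.mul_assoc, hU.eigenColumns_zero_conjTranspose_mul, Matrix.zero_mul]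
  have hproj : (1 - j * jᴴ) * (1 - P) = 0 := by
    have hinv : shiftedPinv U e 0 * (A * Aᴴ) = 1 - j * jᴴ := by
      simpa using hU.shiftedPinv_mul_sub 0
    rw [← hinv, Matrix.mul_assoc, Matrix.mul_assoc A, Matrix.mul_sub Aᴴ, hAP, Matrix.mul_one,
      sub_self, Matrix.mul_zero, Matrix.mul_zero]
  rw [Matrix.sub_mul, Matrix.one_mul, Matrix.mul_assoc, Matrix.mul_sub jᴴ, hjP, Matrix.mul_one,
    sub_zero, sub_sub, add_comm, ← sub_sub, sub_eq_zero] at hproj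
  exact hproj.symm

theorem isGeneralizedInverse_zero (hV : IsUnitaryDiagonalization (Aᴴ * A) V d)
    (hU : IsUnitaryDiagonalization (A * Aᴴ) U e) :
    IsGeneralizedInverse A (shiftedPinv V d 0 * Aᴴ)
      (eigenColumns V d 0) (eigenColumns V d 0)ᴴ (eigenColumns U e 0)ᴴ (eigenColumns U e 0) where
  inv_mul := by simpa [Matrix.mul_assoc] using hV.shiftedPinv_mul_sub 0
  mul_inv := hV.mul_shiftedPinv_zero_mul hU
  ker_coord_mul_inv := by
    rw [← Matrix.mul_assoc, hV.eigenColumns_conjTranspose_mul_shiftedPinv, Matrix.zero_mul]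
  ker_coord_mul_ker := hV.eigenColumns_conjTranspose_mul_self 0
  coker_mul := hU.eigenColumns_zero_conjTranspose_mul

end MulConjTranspose

end IsUnitaryDiagonalization

end Spectral

instance continuousSMul_selfAdjoint (R A : Type*) [Semiring R] [StarRing R] [TrivialStar R]
    [TopologicalSpace R] [AddCommGroup A] [Module R A] [StarAddMonoid A] [StarModule R A]
    [TopologicalSpace A] [ContinuousSMul R A] : ContinuousSMul R (selfAdjoint A) :=
  inferInstanceAs (ContinuousSMul R (selfAdjoint.submodule R A))

section RealDimension

instance finiteDimensional_selfAdjoint (A : Type*) [AddCommGroup A] [Module ℂ A] [StarAddMonoid A]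
    [StarModule ℂ A] [FiniteDimensional ℂ A] : FiniteDimensional ℝ (selfAdjoint A) :=
  have : FiniteDimensional ℝ A := FiniteDimensional.complexToReal A
  FiniteDimensional.finiteDimensional_submodule (selfAdjoint.submodule ℝ A)

theorem finrank_real_selfAdjoint (A : Type*) [AddCommGroup A] [Module ℂ A] [StarAddMonoid A]
    [StarModule ℂ A] [FiniteDimensional ℂ A] :
    Module.finrank ℝ (selfAdjoint A) = Module.finrank ℂ A := by
  have hbij : Function.Bijective (realPart.prod imaginaryPart : A →ₗ[ℝ] _) := by
    refine ⟨fun x y hxy => ?_, fun ⟨x, y⟩ => ⟨x + Complex.I • (y : A), by simp⟩⟩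
    exact ComplexStarModule.ext (Prod.ext_iff.mp hxy).1 (Prod.ext_iff.mp hxy).2
  have hprod := (LinearEquiv.ofBijective _ hbij).finrank_eq
  rw [Module.finrank_prod, finrank_real_of_complex] at hprod
  lia

theorem finrank_selfAdjoint_matrix (k : Type*) [Fintype k] :
    Module.finrank ℝ (selfAdjoint (Matrix k k ℂ)) = Fintype.card k ^ 2 := by
  rw [finrank_real_selfAdjoint, Module.finrank_matrix, Module.finrank_self, mul_one, sq]

theorem finrank_real_matrix (m n : Type*) [Fintype m] [Fintype n] :
    Module.finrank ℝ (Matrix m n ℂ) = 2 * (Fintype.card m * Fintype.card n) := by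
  rw [finrank_real_of_complex, Module.finrank_matrix, Module.finrank_self, mul_one]

end RealDimension

section SingularValues

theorem conjTranspose_mul_self_of_orthonormalBasis {ι : Type*} [Fintype ι] [DecidableEq ι]
    (b : OrthonormalBasis ι ℂ (EuclideanSpace ℂ ι)) :
    (Matrix.of fun i j => b j i)ᴴ * Matrix.of (fun i j => b j i) = 1 := by
  ext i j
  rw [Matrix.one_apply, ← orthonormal_iff_ite.mp b.orthonormal i j]
  simp [Matrix.mul_apply, PiLp.inner_apply, mul_comm]

variable {m n : ℕ}

theorem exists_isUnitaryDiagonalization_conjTranspose_mul_self (A : Matrix (Fin m) (Fin n) ℂ) :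
    ∃ V, IsUnitaryDiagonalization (Aᴴ * A) V fun j => matrixSingularValue A j ^ 2 := by
  have hn : Module.finrank ℂ (EuclideanSpace ℂ (Fin n)) = n := finrank_euclideanSpace_fin
  set T := Matrix.toEuclideanLin A
  let b := T.isSymmetric_adjoint_comp_self.eigenvectorBasis hn
  let V : Matrix (Fin n) (Fin n) ℂ := Matrix.of fun i j => b j i
  have hV : Vᴴ * V = 1 := conjTranspose_mul_self_of_orthonormalBasis b
  refine ⟨V, hV, ?_⟩
  have heigen : Aᴴ * A * V
      = V * diagonal (fun j : Fin n => ((matrixSingularValue A j ^ 2 : ℝ) : ℂ)) := by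
    ext i j
    have hb : Matrix.toEuclideanLin Aᴴ (T (b j)) = ((T.singularValues j ^ 2 : ℝ) : ℂ) • b j := by
      rw [Matrix.toEuclideanLin_conjTranspose_eq_adjoint, T.sq_singularValues_fin hn j]
      exact T.isSymmetric_adjoint_comp_self.apply_eigenvectorBasis hn j
    have hcol : (Aᴴ * A * V) i j = (Aᴴ *ᵥ (A *ᵥ fun a => b j a)) i := by
      rw [mulVec_mulVec]
      rfl
    rw [Matrix.mul_diagonal, mul_comm, hcol]
    exact congrArg (fun v : EuclideanSpace ℂ (Fin n) => v i) hb
  calc Aᴴ * A = Aᴴ * A * V * Vᴴ := by rw [Matrix.mul_assoc, mul_eq_one_comm.mp hV, Matrix.mul_one]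
    _ = _ := congrArg (· * Vᴴ) heigen

end SingularValues

section Strata

variable {m n : ℕ}

/-- The distinct nonzero eigenvalues of `Aᴴ * A`, that is, the squares of the distinct nonzero
singular values of `A`. -/
noncomputable def posSpectrum (A : Matrix (Fin m) (Fin n) ℂ) : Finset ℝ :=
  (Finset.univ.image fun j : Fin n => matrixSingularValue A j ^ 2).erase 0

/-- The multiplicity of `μ` as an eigenvalue of `Aᴴ * A`. -/
noncomputable def eigenMult (A : Matrix (Fin m) (Fin n) ℂ) (μ : ℝ) : ℕ :=
  Fintype.card {j : Fin n // matrixSingularValue A j ^ 2 = μ}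

/-- The matrices of rank `ρ` with `r` distinct positive singular values, whose multiplicities
have square sum `c`. These three numbers determine the dimension of the set near each point. -/
def singularStratum (m n ρ r c : ℕ) : Set (Matrix (Fin m) (Fin n) ℂ) :=
  {A | A.rank = ρ ∧ (posSpectrum A).card = r ∧ ∑ μ ∈ posSpectrum A, eigenMult A μ ^ 2 = c}

variable {A : Matrix (Fin m) (Fin n) ℂ} {μ : ℝ}

theorem pos_of_mem_posSpectrum (hμ : μ ∈ posSpectrum A) : 0 < μ := by
  simp only [posSpectrum, Finset.mem_erase, Finset.mem_image, Finset.mem_univ, true_and] at hμ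
  obtain ⟨hne, j, rfl⟩ := hμ
  exact (sq_nonneg _).lt_of_ne' hne

theorem eigenMult_pos_iff : 0 < eigenMult A μ ↔ ∃ j : Fin n, matrixSingularValue A j ^ 2 = μ := by
  simp [eigenMult, Fintype.card_pos_iff]

theorem mem_posSpectrum_iff : μ ∈ posSpectrum A ↔ μ ≠ 0 ∧ 0 < eigenMult A μ := by
  simp [eigenMult_pos_iff, posSpectrum]

theorem rank_sub_smul_one_add_eigenMult (A : Matrix (Fin m) (Fin n) ℂ) (μ : ℝ) :
    (Aᴴ * A - (μ : ℂ) • (1 : Matrix (Fin n) (Fin n) ℂ)).rank + eigenMult A μ = n := by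
  obtain ⟨V, hV⟩ := exists_isUnitaryDiagonalization_conjTranspose_mul_self A
  exact (hV.rank_sub_smul_one_add_card μ).trans (Fintype.card_fin n)

open scoped ComplexOrder in
theorem rank_add_eigenMult_zero (A : Matrix (Fin m) (Fin n) ℂ) : A.rank + eigenMult A 0 = n := by
  simpa [rank_conjTranspose_mul_self] using rank_sub_smul_one_add_eigenMult A 0

theorem IsUnitaryDiagonalization.eigenMult_eq_card {V : Matrix (Fin n) (Fin n) ℂ} {d : Fin n → ℝ}
    (h : IsUnitaryDiagonalization (Aᴴ * A) V d) (μ : ℝ) :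
    eigenMult A μ = Fintype.card {j // d j = μ} := by
  have hrank := h.rank_sub_smul_one_add_card μ
  rw [Fintype.card_fin] at hrank
  exact Nat.add_left_cancel ((rank_sub_smul_one_add_eigenMult A μ).trans hrank.symm)

theorem sum_eigenMult (A : Matrix (Fin m) (Fin n) ℂ) :
    ∑ μ ∈ posSpectrum A, eigenMult A μ = A.rank := by
  have hcard : n = ∑ μ ∈ insert 0 (posSpectrum A), eigenMult A μ := by
    have hfiber := Finset.card_eq_sum_card_fiberwise (s := Finset.univ)
      (f := fun j : Fin n => matrixSingularValue A j ^ 2) (t := insert 0 (posSpectrum A))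
      fun j _ => by simp [posSpectrum]
    simpa [eigenMult, Fintype.card_subtype] using hfiber
  rw [Finset.sum_insert (by simp [posSpectrum])] at hcard
  have hrank := rank_add_eigenMult_zero A
  lia

theorem card_posSpectrum_le_rank (A : Matrix (Fin m) (Fin n) ℂ) :
    (posSpectrum A).card ≤ A.rank := by
  rw [← sum_eigenMult, Finset.card_eq_sum_ones]
  exact Finset.sum_le_sum fun μ hμ => (mem_posSpectrum_iff.mp hμ).2

end Strata

section SpectrumPerturbation

variable {m n : ℕ} {μ ε : ℝ}

theorem eventually_exists_eigenvalue_near {A₀ : Matrix (Fin m) (Fin n) ℂ}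
    (hμ : 0 < eigenMult A₀ μ) (hε : 0 < ε) :
    ∀ᶠ A in 𝓝 A₀, ∃ j : Fin n, |matrixSingularValue A j ^ 2 - μ| < ε := by
  let χ : Matrix (Fin m) (Fin n) ℂ → ℂ := fun A => (Aᴴ * A - (μ : ℂ) • 1).det
  have hχ : Continuous χ := by fun_prop
  have hzero : χ A₀ = 0 := by
    obtain ⟨V, hV⟩ := exists_isUnitaryDiagonalization_conjTranspose_mul_self A₀
    obtain ⟨j, hj⟩ := eigenMult_pos_iff.mp hμ
    exact ((hV.sub_smul_one μ).det_eq_prod).trans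
      (Finset.prod_eq_zero (Finset.mem_univ j) (by simp [← hj]))
  filter_upwards [hχ.norm.continuousAt.eventually_lt_const (u := ε ^ Fintype.card (Fin n))
    (by simpa [hzero] using pow_pos hε n)] with A hA
  obtain ⟨V, hV⟩ := exists_isUnitaryDiagonalization_conjTranspose_mul_self A
  exact (hV.sub_smul_one μ).exists_abs_lt_of_norm_det_lt hε.le hA

theorem eventually_exists_posSpectrum_near (A₀ : Matrix (Fin m) (Fin n) ℂ) (hε : 0 < ε)
    (hpos : ∀ μ ∈ posSpectrum A₀, ε < μ) :
    ∀ᶠ A in 𝓝 A₀, ∀ μ ∈ posSpectrum A₀, ∃ ν ∈ posSpectrum A, |ν - μ| < ε := by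
  rw [eventually_all_finset]
  intro μ hμ
  filter_upwards [eventually_exists_eigenvalue_near (mem_posSpectrum_iff.mp hμ).2 hε] with A hA
  obtain ⟨j, hj⟩ := hA
  refine ⟨_, mem_posSpectrum_iff.mpr ⟨fun hzero => ?_, eigenMult_pos_iff.mpr ⟨j, rfl⟩⟩, hj⟩
  rw [hzero, zero_sub, abs_neg] at hj
  exact (hpos μ hμ).not_ge ((le_abs_self μ).trans hj.le)

theorem eventually_separated (s : Finset ℝ) :
    ∀ᶠ ε in 𝓝[>] (0 : ℝ), ∀ μ ∈ s, ∀ ν ∈ s, ∀ x : ℝ, |x - μ| < ε → |x - ν| < ε → μ = ν := by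
  simp only [eventually_all_finset]
  intro μ _ ν _
  by_cases hμν : μ = ν
  · exact Eventually.of_forall fun _ _ _ _ => hμν
  have hdist : 0 < |μ - ν| / 2 := half_pos (abs_pos.mpr (sub_ne_zero.mpr hμν))
  filter_upwards [nhdsWithin_le_nhds (eventually_lt_nhds hdist)] with ε hε x hxμ hxν
  have htri := abs_sub_le μ x ν
  rw [abs_sub_comm μ x] at htri
  linarith

theorem eventually_lt_posSpectrum (A : Matrix (Fin m) (Fin n) ℂ) :
    ∀ᶠ ε in 𝓝[>] (0 : ℝ), ∀ μ ∈ posSpectrum A, ε < μ := by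
  rw [eventually_all_finset]
  exact fun μ hμ => nhdsWithin_le_nhds (eventually_lt_nhds (pos_of_mem_posSpectrum hμ))

theorem eventually_card_posSpectrum_le (A₀ : Matrix (Fin m) (Fin n) ℂ) :
    ∀ᶠ A in 𝓝 A₀, (posSpectrum A₀).card ≤ (posSpectrum A).card := by
  obtain ⟨ε, hε, hpos, hsep⟩ := (eventually_mem_nhdsWithin.and
    ((eventually_lt_posSpectrum A₀).and (eventually_separated (posSpectrum A₀)))).exists
  filter_upwards [eventually_exists_posSpectrum_near A₀ hε hpos] with A hA
  choose! f hf hnear using hA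
  refine Finset.card_le_card_of_injOn f hf fun μ hμ ν hν hμν => ?_
  exact hsep μ hμ ν hν (f μ) (hnear μ hμ) (hμν ▸ hnear ν hν)

end SpectrumPerturbation

section ShiftDiff

variable {m n : Type*} [Fintype m] [DecidableEq n]

/-- The change of `Aᴴ * A - x` from its value at `A = A₀`, `x = μ`. -/
noncomputable def shiftDiff (A₀ : Matrix m n ℂ) (μ : ℝ) (A : Matrix m n ℂ) (x : ℝ) :
    Matrix n n ℂ :=
  Aᴴ * A - (x : ℂ) • 1 - (A₀ᴴ * A₀ - (μ : ℂ) • 1)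

theorem shiftDiff_self (A₀ : Matrix m n ℂ) (μ : ℝ) : shiftDiff A₀ μ A₀ μ = 0 :=
  sub_self _

theorem sub_smul_one_add_shiftDiff (A₀ A : Matrix m n ℂ) (μ x : ℝ) :
    A₀ᴴ * A₀ - (μ : ℂ) • 1 + shiftDiff A₀ μ A x = Aᴴ * A - (x : ℂ) • 1 :=
  add_sub_cancel _ _

theorem isHermitian_shiftDiff (A₀ A : Matrix m n ℂ) (μ x : ℝ) :
    (shiftDiff A₀ μ A x).IsHermitian := by
  simp [Matrix.IsHermitian, shiftDiff, conjTranspose_sub, conjTranspose_mul, conjTranspose_smul]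

variable {E : Type*} [NormedAddCommGroup E] [NormedSpace ℝ E] {f : E → Matrix m n ℂ}
  {g : E → ℝ}

theorem contDiff_shiftDiff [Fintype n] {r : WithTop ℕ∞} (A₀ : Matrix m n ℂ) (μ : ℝ)
    (hf : ContDiff ℝ r f) (hg : ContDiff ℝ r g) :
    ContDiff ℝ r fun y => shiftDiff A₀ μ (f y) (g y) :=
  ((contDiff_matrix_mul (contDiff_conjTranspose hf) hf).sub
    ((Complex.ofRealCLM.contDiff.comp hg).smul contDiff_const)).sub contDiff_const

theorem fderiv_shiftDiff_apply [Finite n] (A₀ : Matrix m n ℂ) (μ : ℝ) {x : E}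
    (hf : DifferentiableAt ℝ f x) (hg : DifferentiableAt ℝ g x) (v : E) :
    fderiv ℝ (fun y => shiftDiff A₀ μ (f y) (g y)) x v
      = (f x)ᴴ * fderiv ℝ f x v + (fderiv ℝ f x v)ᴴ * f x - ((fderiv ℝ g x v : ℝ) : ℂ) • 1 := by
  have := Fintype.ofFinite n
  have hstar : DifferentiableAt ℝ (fun y => (f y)ᴴ) x :=
    ((contDiff_conjTranspose contDiff_id).differentiable one_ne_zero _).comp x hf
  have hsmul : HasFDerivAt (fun y => ((g y : ℝ) : ℂ) • (1 : Matrix n n ℂ)) _ x :=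
    (Complex.ofRealCLM.hasFDerivAt.comp x hg.hasFDerivAt).smul_const 1
  have hmul := differentiableAt_matrix_mul hstar hf
  have hdiff := ((hmul.hasFDerivAt.sub hsmul).sub_const (A₀ᴴ * A₀ - (μ : ℂ) • 1)).fderiv
  calc fderiv ℝ (fun y => shiftDiff A₀ μ (f y) (g y)) x v
      = fderiv ℝ (fun y => (f y)ᴴ * f y) x v - ((fderiv ℝ g x v : ℝ) : ℂ) • 1 := congr($hdiff v)
    _ = _ := by rw [fderiv_matrix_mul_apply hstar hf, fderiv_conjTranspose_apply hf]

theorem fderiv_schurComplement_shiftDiff_apply [Fintype n] {k l : Type*} [Finite k] [Finite l]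
    (π : Matrix l n ℂ) (G : Matrix n n ℂ) (ι : Matrix n k ℂ) (hf : ContDiff ℝ 1 f)
    (hg : ContDiff ℝ 1 g) (x v : E) :
    fderiv ℝ (fun y => schurComplement π G ι (shiftDiff (f x) (g x) (f y) (g y))) x v
      = π * (((f x)ᴴ * fderiv ℝ f x v + (fderiv ℝ f x v)ᴴ * f x
          - ((fderiv ℝ g x v : ℝ) : ℂ) • 1) * ι) := by
  rw [fderiv_schurComplement_apply ((contDiff_shiftDiff _ _ hf hg).differentiable one_ne_zero x)
    (shiftDiff_self (f x) (g x)), fderiv_shiftDiff_apply _ _ (hf.differentiable one_ne_zero x)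
    (hg.differentiable one_ne_zero x)]

end ShiftDiff

section StratumEquation

variable {m n : Type*} [Fintype m] [Fintype n] [DecidableEq n]

/-- The equations in `(A, x)` that express, for `A` near `A₀`, that `A` has the rank of `A₀` and
that `x μ` is an eigenvalue of `Aᴴ * A` with the multiplicity that `μ` has for `A₀ᴴ * A₀`, for all
`μ` in `s`. Here `V`, `d` diagonalize `A₀ᴴ * A₀` and `U`, `e` diagonalize `A₀ * A₀ᴴ`. Near
`(A₀, μ)` the first Schur complement is Hermitian, so taking its self-adjoint part loses nothing. -/
noncomputable def stratumEquation (A₀ : Matrix m n ℂ) (V : Matrix n n ℂ) (d : n → ℝ)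
    (U : Matrix m m ℂ) (e : m → ℝ) (s : Finset ℝ) (z : Matrix m n ℂ × (s → ℝ)) :
    ((μ : s) → selfAdjoint (Matrix {j // d j = μ} {j // d j = μ} ℂ)) ×
      Matrix {i // e i = 0} {j // d j = 0} ℂ :=
  (fun μ => selfAdjointPartL ℝ _ (schurComplement (eigenColumns V d μ)ᴴ (shiftedPinv V d μ)
      (eigenColumns V d μ) (shiftDiff A₀ μ z.1 (z.2 μ))),
    schurComplement (eigenColumns U e 0)ᴴ (shiftedPinv V d 0 * A₀ᴴ) (eigenColumns V d 0)
      (z.1 - A₀))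

variable (A₀ : Matrix m n ℂ) (V : Matrix n n ℂ) (d : n → ℝ) (U : Matrix m m ℂ) (e : m → ℝ)
  (s : Finset ℝ)

theorem contDiff_stratumEquation {r : WithTop ℕ∞} :
    ContDiff ℝ r (stratumEquation A₀ V d U e s) := by
  refine .prodMk (contDiff_pi.mpr fun μ => ?_)
    (contDiff_schurComplement (contDiff_fst.sub contDiff_const))
  exact (selfAdjointPartL ℝ (Matrix {j // d j = μ} {j // d j = μ} ℂ)).contDiff.comp
    (contDiff_schurComplement
      (contDiff_shiftDiff A₀ μ contDiff_fst ((contDiff_apply ℝ ℝ μ).comp contDiff_snd)))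

theorem stratumEquation_self : stratumEquation A₀ V d U e s (A₀, (↑)) = 0 := by
  refine Prod.ext (funext fun μ => ?_) ?_
  · simp [stratumEquation, shiftDiff_self, schurComplement]
  · simp [stratumEquation, schurComplement]

theorem fderiv_stratumEquation_apply (v : Matrix m n ℂ × (s → ℝ)) :
    fderiv ℝ (stratumEquation A₀ V d U e s) (A₀, (↑)) v
      = (fun μ : s => selfAdjointPartL ℝ _ ((eigenColumns V d μ)ᴴ *
          ((A₀ᴴ * v.1 + v.1ᴴ * A₀ - (v.2 μ : ℂ) • 1) * eigenColumns V d μ)),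
        (eigenColumns U e 0)ᴴ * (v.1 * eigenColumns V d 0)) := by
  let S (μ : s) (z : Matrix m n ℂ × (s → ℝ)) : Matrix {j // d j = μ} {j // d j = μ} ℂ :=
    schurComplement (eigenColumns V d μ)ᴴ (shiftedPinv V d μ) (eigenColumns V d μ)
      (shiftDiff A₀ μ z.1 (z.2 μ))
  have hcoord (μ : s) : ContDiff ℝ 1 fun z : Matrix m n ℂ × (s → ℝ) => z.2 μ :=
    (contDiff_apply ℝ ℝ μ).comp contDiff_snd
  have hS (μ : s) : HasFDerivAt (fun z => selfAdjointPartL ℝ _ (S μ z))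
      ((selfAdjointPartL ℝ _).comp (fderiv ℝ (S μ) (A₀, (↑)))) (A₀, (↑)) :=
    (selfAdjointPartL ℝ (Matrix {j // d j = μ} {j // d j = μ} ℂ)).hasFDerivAt.comp _
      ((contDiff_schurComplement (contDiff_shiftDiff A₀ μ contDiff_fst (hcoord μ))).differentiable
        one_ne_zero _).hasFDerivAt
  have hsub : ContDiff ℝ 1 fun z : Matrix m n ℂ × (s → ℝ) => z.1 - A₀ :=
    contDiff_fst.sub contDiff_const
  have hderiv : HasFDerivAt (stratumEquation A₀ V d U e s) _ (A₀, (↑)) :=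
    (hasFDerivAt_pi.mpr hS).prodMk
      ((contDiff_schurComplement hsub).differentiable one_ne_zero _).hasFDerivAt
  have hfst : fderiv ℝ (Prod.fst : Matrix m n ℂ × (s → ℝ) → Matrix m n ℂ) (A₀, (↑)) v = v.1 :=
    congr($(hasFDerivAt_fst.fderiv) v)
  refine congr($(hderiv.fderiv) v).trans (Prod.ext (funext fun μ => ?_) ?_)
  · have hsnd : fderiv ℝ (fun z : Matrix m n ℂ × (s → ℝ) => z.2 μ) (A₀, (↑)) v = v.2 μ :=
      congr($(((ContinuousLinearMap.proj μ).comp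
        (ContinuousLinearMap.snd ℝ (Matrix m n ℂ) (s → ℝ))).fderiv) v)
    refine congrArg (selfAdjointPartL ℝ _) ((fderiv_schurComplement_shiftDiff_apply _ _ _
      contDiff_fst (hcoord μ) (A₀, (↑)) v).trans ?_)
    exact congr((eigenColumns V d μ)ᴴ *
      ((A₀ᴴ * $hfst + ($hfst)ᴴ * A₀ - (($hsnd : ℝ) : ℂ) • 1) * eigenColumns V d μ))
  · have hsubv : fderiv ℝ (fun z : Matrix m n ℂ × (s → ℝ) => z.1 - A₀) (A₀, (↑)) v = v.1 :=
      (congr($(fderiv_sub_const (f := Prod.fst) A₀) v)).trans hfst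
    exact (fderiv_schurComplement_apply (hsub.differentiable one_ne_zero (A₀, (↑)))
      (sub_self A₀) v).trans congr((eigenColumns U e 0)ᴴ * ($hsubv * eigenColumns V d 0))

end StratumEquation

section StratumTangent

variable {m n : Type*} [Fintype m] [Fintype n] [DecidableEq n]
  {A : Matrix m n ℂ} {V : Matrix n n ℂ} {d : n → ℝ} {U : Matrix m m ℂ} {e : m → ℝ}

/-- A direction in which the derivative of `stratumEquation` at `A` takes the value `(B, C)`, see
`fderiv_stratumEquation_preimage`. Its columns in the `μ`-eigenspace are `(2 * μ)⁻¹ • A * E * B μ`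
with `E = eigenColumns V d μ`, because `Aᴴ * A * E = μ • E`. -/
noncomputable def stratumEquationPreimage (A : Matrix m n ℂ) (V : Matrix n n ℂ) (d : n → ℝ)
    (U : Matrix m m ℂ) (e : m → ℝ) {s : Finset ℝ}
    (B : (μ : s) → Matrix {j // d j = μ} {j // d j = μ} ℂ)
    (C : Matrix {i // e i = 0} {j // d j = 0} ℂ) : Matrix m n ℂ :=
  ∑ μ : s, (2 * (μ : ℂ))⁻¹ • (A * eigenColumns V d μ * B μ * (eigenColumns V d μ)ᴴ)
    + eigenColumns U e 0 * C * (eigenColumns V d 0)ᴴ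

variable {s : Finset ℝ} (B : (μ : s) → Matrix {j // d j = μ} {j // d j = μ} ℂ)
  (C : Matrix {i // e i = 0} {j // d j = 0} ℂ)

theorem stratumEquationPreimage_mul_eigenColumns (hV : IsUnitaryDiagonalization (Aᴴ * A) V d)
    (hs : ∀ μ ∈ s, μ ≠ 0) (μ : s) :
    stratumEquationPreimage A V d U e B C * eigenColumns V d μ
      = (2 * (μ : ℂ))⁻¹ • (A * eigenColumns V d μ * B μ) := by
  rw [stratumEquationPreimage, Matrix.add_mul, Matrix.sum_mul, Finset.sum_eq_single μ]
  · simp [Matrix.mul_assoc, hV.eigenColumns_conjTranspose_mul_self,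
      hV.eigenColumns_conjTranspose_mul_of_ne (hs μ μ.2).symm]
  · intro ν _ hν
    simp [Matrix.mul_assoc, hV.eigenColumns_conjTranspose_mul_of_ne (Subtype.coe_ne_coe.mpr hν)]
  · exact fun h => absurd (Finset.mem_univ μ) h

theorem stratumEquationPreimage_mul_eigenColumns_zero
    (hV : IsUnitaryDiagonalization (Aᴴ * A) V d) (hs : ∀ μ ∈ s, μ ≠ 0) :
    stratumEquationPreimage A V d U e B C * eigenColumns V d 0 = eigenColumns U e 0 * C := by
  rw [stratumEquationPreimage, Matrix.add_mul, Matrix.sum_mul, Finset.sum_eq_zero, zero_add]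
  · rw [Matrix.mul_assoc, hV.eigenColumns_conjTranspose_mul_self, Matrix.mul_one]
  · intro μ _
    simp [Matrix.mul_assoc, hV.eigenColumns_conjTranspose_mul_of_ne (hs μ μ.2)]

theorem eigenColumns_conjTranspose_mul_gram_deriv_mul
    (hV : IsUnitaryDiagonalization (Aᴴ * A) V d) {μ : ℝ} (hμ : μ ≠ 0)
    {X : Matrix {j // d j = μ} {j // d j = μ} ℂ} (hX : X.IsHermitian) {v : Matrix m n ℂ}
    (hv : v * eigenColumns V d μ = (2 * (μ : ℂ))⁻¹ • (A * eigenColumns V d μ * X)) :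
    (eigenColumns V d μ)ᴴ * ((Aᴴ * v + vᴴ * A) * eigenColumns V d μ) = X := by
  have hhalf : (eigenColumns V d μ)ᴴ * (Aᴴ * (v * eigenColumns V d μ)) = (2 : ℂ)⁻¹ • X := by
    have hgram : Aᴴ * (A * eigenColumns V d μ * X) = (μ : ℂ) • (eigenColumns V d μ * X) := by
      rw [← Matrix.mul_assoc, ← Matrix.mul_assoc, hV.mul_eigenColumns, Matrix.smul_mul]
      rfl
    have hμ' : (μ : ℂ) ≠ 0 := Complex.ofReal_ne_zero.mpr hμ
    rw [hv, Matrix.mul_smul, hgram, Matrix.mul_smul, Matrix.mul_smul, ← Matrix.mul_assoc,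
      hV.eigenColumns_conjTranspose_mul_self, Matrix.one_mul, smul_smul]
    congr 1
    field_simp
  have hhalf' : (eigenColumns V d μ)ᴴ * (vᴴ * (A * eigenColumns V d μ)) = (2 : ℂ)⁻¹ • X := by
    simpa [conjTranspose_mul, hX.eq, Matrix.mul_assoc] using congrArg conjTranspose hhalf
  rw [Matrix.add_mul, Matrix.mul_add, Matrix.mul_assoc, Matrix.mul_assoc, hhalf, hhalf',
    ← add_smul]
  norm_num

theorem fderiv_stratumEquation_preimage [DecidableEq m]
    (hV : IsUnitaryDiagonalization (Aᴴ * A) V d)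
    (hU : IsUnitaryDiagonalization (A * Aᴴ) U e) (hs : ∀ μ ∈ s, μ ≠ 0)
    (B : (μ : s) → selfAdjoint (Matrix {j // d j = μ} {j // d j = μ} ℂ)) :
    fderiv ℝ (stratumEquation A V d U e s) (A, (↑))
      (stratumEquationPreimage A V d U e (fun μ => (B μ).1) C, 0) = (B, C) := by
  rw [fderiv_stratumEquation_apply]
  refine Prod.ext (funext fun μ => ?_) ?_
  · simp only [Pi.zero_apply, Complex.ofReal_zero, zero_smul, sub_zero]
    have hgram := eigenColumns_conjTranspose_mul_gram_deriv_mul hV (hs μ μ.2) (B μ).2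
      (stratumEquationPreimage_mul_eigenColumns (U := U) (fun μ => (B μ).1) C hV hs μ)
    exact Subtype.ext ((IsSelfAdjoint.coe_selfAdjointPart_apply ℝ
      (hgram.symm ▸ (B μ).2)).trans hgram)
  · rw [stratumEquationPreimage_mul_eigenColumns_zero _ C hV hs, ← Matrix.mul_assoc,
      hU.eigenColumns_conjTranspose_mul_self, Matrix.one_mul]

theorem eq_zero_of_fderiv_stratumEquation_eq_zero (hV : IsUnitaryDiagonalization (Aᴴ * A) V d)
    (hs : ∀ μ ∈ s, ∃ j, d j = μ) {w : s → ℝ}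
    (hw : fderiv ℝ (stratumEquation A V d U e s) (A, (↑)) (0, w) = 0) : w = 0 := by
  rw [fderiv_stratumEquation_apply] at hw
  funext μ
  have hμ := congrFun (congrArg Prod.fst hw) μ
  obtain ⟨j, hj⟩ := hs μ μ.2
  simp only [Matrix.mul_zero, conjTranspose_zero, Matrix.zero_mul, add_zero, zero_sub,
    Matrix.neg_mul, Matrix.mul_neg, Matrix.smul_mul, Matrix.one_mul, Matrix.mul_smul,
    hV.eigenColumns_conjTranspose_mul_self] at hμ
  have hsa : IsSelfAdjoint (-((w μ : ℂ) • (1 : Matrix {j // d j = μ} {j // d j = μ} ℂ))) := by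
    simp [IsSelfAdjoint]
  have hzero := (hsa.coe_selfAdjointPart_apply ℝ).symm.trans (congrArg Subtype.val hμ)
  simpa using congrFun (congrFun hzero ⟨j, hj⟩) ⟨j, hj⟩

end StratumTangent

section LocalEquations

variable {m n : ℕ} {A₀ A : Matrix (Fin m) (Fin n) ℂ} {V : Matrix (Fin n) (Fin n) ℂ}
  {d : Fin n → ℝ} {U : Matrix (Fin m) (Fin m) ℂ} {e : Fin m → ℝ} {μ x : ℝ}

theorem eigenMult_le_of_det_ne_zero (hV : IsUnitaryDiagonalization (A₀ᴴ * A₀) V d)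
    (hdet : (1 + shiftedPinv V d μ * shiftDiff A₀ μ A x).det ≠ 0) :
    eigenMult A x ≤ eigenMult A₀ μ := by
  have hrank := (hV.isGeneralizedInverse_sub μ).card_le_rank_add_card hdet
  have hmult := rank_sub_smul_one_add_eigenMult A x
  rw [← sub_smul_one_add_shiftDiff A₀ A μ x] at hmult
  rw [Fintype.card_fin, ← hV.eigenMult_eq_card] at hrank
  exact Nat.add_le_add_iff_left.mp (hmult.trans_le hrank)

theorem eigenMult_eq_iff_schurComplement_eq_zero
    (hV : IsUnitaryDiagonalization (A₀ᴴ * A₀) V d)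
    (hdet : (1 + shiftedPinv V d μ * shiftDiff A₀ μ A x).det ≠ 0) :
    eigenMult A x = eigenMult A₀ μ ↔
      selfAdjointPartL ℝ _ (schurComplement (eigenColumns V d μ)ᴴ (shiftedPinv V d μ)
        (eigenColumns V d μ) (shiftDiff A₀ μ A x)) = 0 := by
  have hrank := (hV.isGeneralizedInverse_sub μ).rank_add_card_eq_iff_schurComplement_eq_zero hdet
  have hmult := rank_sub_smul_one_add_eigenMult A x
  rw [← sub_smul_one_add_shiftDiff A₀ A μ x] at hmult
  rw [Fintype.card_fin, ← hV.eigenMult_eq_card] at hrank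
  have hsa := (isHermitian_schurComplement (eigenColumns V d μ) (isHermitian_shiftedPinv V d μ)
    (isHermitian_shiftDiff A₀ A μ x) hdet).isSelfAdjoint.coe_selfAdjointPart_apply ℝ
  rw [← Subtype.coe_inj]
  exact Iff.trans ⟨fun h => h ▸ hmult, fun h => Nat.add_left_cancel (hmult.trans h.symm)⟩
    (hrank.trans (Eq.congr_left hsa.symm))

theorem rank_le_of_det_ne_zero (hV : IsUnitaryDiagonalization (A₀ᴴ * A₀) V d)
    (hU : IsUnitaryDiagonalization (A₀ * A₀ᴴ) U e)
    (hdet : (1 + shiftedPinv V d 0 * A₀ᴴ * (A - A₀)).det ≠ 0) : A₀.rank ≤ A.rank := by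
  have hrank := (hV.isGeneralizedInverse_zero hU).card_le_rank_add_card hdet
  rw [add_sub_cancel, Fintype.card_fin, ← hV.eigenMult_eq_card] at hrank
  exact Nat.add_le_add_iff_right.mp ((rank_add_eigenMult_zero A₀).trans_le hrank)

theorem rank_eq_iff_schurComplement_eq_zero (hV : IsUnitaryDiagonalization (A₀ᴴ * A₀) V d)
    (hU : IsUnitaryDiagonalization (A₀ * A₀ᴴ) U e)
    (hdet : (1 + shiftedPinv V d 0 * A₀ᴴ * (A - A₀)).det ≠ 0) :
    A.rank = A₀.rank ↔ schurComplement (eigenColumns U e 0)ᴴ (shiftedPinv V d 0 * A₀ᴴ)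
      (eigenColumns V d 0) (A - A₀) = 0 := by
  have hrank := (hV.isGeneralizedInverse_zero hU).rank_add_card_eq_iff_schurComplement_eq_zero hdet
  rw [add_sub_cancel, Fintype.card_fin, ← hV.eigenMult_eq_card] at hrank
  rw [← hrank, ← Nat.add_right_cancel_iff (n := eigenMult A₀ 0), rank_add_eigenMult_zero]

theorem exists_isUnitaryDiagonalization_mul_conjTranspose_self (A : Matrix (Fin m) (Fin n) ℂ) :
    ∃ U, IsUnitaryDiagonalization (A * Aᴴ) U fun i => matrixSingularValue Aᴴ i ^ 2 := by
  simpa using exists_isUnitaryDiagonalization_conjTranspose_mul_self Aᴴ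

theorem eventually_det_one_add_mul_sub_ne_zero (A₀ : Matrix (Fin m) (Fin n) ℂ)
    (G : Matrix (Fin n) (Fin m) ℂ) : ∀ᶠ A in 𝓝 A₀, (1 + G * (A - A₀)).det ≠ 0 := by
  have hcont : Continuous fun A : Matrix (Fin m) (Fin n) ℂ => (1 + G * (A - A₀)).det := by
    fun_prop
  exact hcont.continuousAt.eventually_ne (by simp)

theorem eventually_rank_le (A₀ : Matrix (Fin m) (Fin n) ℂ) :
    ∀ᶠ A in 𝓝 A₀, A₀.rank ≤ A.rank := by
  obtain ⟨V, hV⟩ := exists_isUnitaryDiagonalization_conjTranspose_mul_self A₀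
  obtain ⟨U, hU⟩ := exists_isUnitaryDiagonalization_mul_conjTranspose_self A₀
  filter_upwards [eventually_det_one_add_mul_sub_ne_zero A₀ _] with A hA
  exact rank_le_of_det_ne_zero hV hU hA

theorem eventually_det_one_add_shiftedPinv_mul_shiftDiff_ne_zero
    (A₀ : Matrix (Fin m) (Fin n) ℂ) (V : Matrix (Fin n) (Fin n) ℂ) (d : Fin n → ℝ)
    (s : Finset ℝ) : ∀ᶠ z : Matrix (Fin m) (Fin n) ℂ × (s → ℝ) in 𝓝 (A₀, (↑)),
      ∀ μ : s, (1 + shiftedPinv V d μ * shiftDiff A₀ μ z.1 (z.2 μ)).det ≠ 0 := by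
  rw [eventually_all]
  intro μ
  have hcont : Continuous fun z : Matrix (Fin m) (Fin n) ℂ × (s → ℝ) =>
      (1 + shiftedPinv V d μ * shiftDiff A₀ μ z.1 (z.2 μ)).det := by
    unfold shiftDiff
    fun_prop
  exact hcont.continuousAt.eventually_ne (by simp [shiftDiff_self])

theorem stratumEquation_eq_zero_iff (hV : IsUnitaryDiagonalization (A₀ᴴ * A₀) V d)
    (hU : IsUnitaryDiagonalization (A₀ * A₀ᴴ) U e) {s : Finset ℝ} {q : s → ℝ}
    (hdet₀ : (1 + shiftedPinv V d 0 * A₀ᴴ * (A - A₀)).det ≠ 0)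
    (hdet : ∀ μ : s, (1 + shiftedPinv V d μ * shiftDiff A₀ μ A (q μ)).det ≠ 0) :
    stratumEquation A₀ V d U e s (A, q) = 0 ↔
      A.rank = A₀.rank ∧ ∀ μ : s, eigenMult A (q μ) = eigenMult A₀ μ := by
  rw [Prod.ext_iff, funext_iff, and_comm, rank_eq_iff_schurComplement_eq_zero hV hU hdet₀]
  exact and_congr_right fun _ => forall_congr' fun μ =>
    (eigenMult_eq_iff_schurComplement_eq_zero hV (hdet μ)).symm

end LocalEquations

section StrataSubmanifold

theorem image_univ_eq_of_sum_eq {α β : Type*} [Fintype α] [DecidableEq β] {q : α → β}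
    {t : Finset β} {b : β → ℕ} (hq : Function.Injective q) (hqt : ∀ a, q a ∈ t)
    (hb : ∀ x ∈ t, 0 < b x) (hsum : ∑ a, b (q a) = ∑ x ∈ t, b x) : Finset.univ.image q = t := by
  have hsub : Finset.univ.image q ⊆ t := by simpa [Finset.image_subset_iff] using hqt
  refine hsub.antisymm fun x hx => ?_
  by_contra hxq
  have hlt := Finset.sum_lt_sum_of_subset hsub hx hxq (hb x hx) fun _ _ _ => Nat.zero_le _
  rw [Finset.sum_image hq.injOn, hsum] at hlt
  exact hlt.false

variable {m n : ℕ} {A₀ A : Matrix (Fin m) (Fin n) ℂ} {q : posSpectrum A₀ → ℝ}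

theorem sum_coe_eigenMult (A : Matrix (Fin m) (Fin n) ℂ) :
    ∑ μ : posSpectrum A, eigenMult A μ = A.rank :=
  (Finset.sum_coe_sort _ (eigenMult A)).trans (sum_eigenMult A)

theorem eigenMult_eq_of_le_of_rank_eq (hq : Function.Injective q)
    (hmem : ∀ μ, q μ ∈ posSpectrum A) (hle : ∀ μ, eigenMult A (q μ) ≤ eigenMult A₀ μ)
    (hrank : A.rank = A₀.rank) (hcard : (posSpectrum A).card = (posSpectrum A₀).card)
    (μ : posSpectrum A₀) : eigenMult A (q μ) = eigenMult A₀ μ := by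
  have himage : Finset.univ.image q = posSpectrum A := by
    refine Finset.eq_of_subset_of_card_le (by simpa [Finset.image_subset_iff] using hmem) ?_
    rw [hcard, Finset.card_image_of_injective _ hq, Finset.card_univ, Fintype.card_coe]
  have hsum : ∑ ν, eigenMult A (q ν) = ∑ ν : posSpectrum A₀, eigenMult A₀ ν := by
    rw [sum_coe_eigenMult, ← hrank, ← sum_eigenMult A, ← himage, Finset.sum_image hq.injOn]
  exact (Finset.sum_eq_sum_iff_of_le fun ν _ => hle ν).mp hsum μ (Finset.mem_univ μ)

theorem mem_singularStratum_of_eigenMult_eq (hq : Function.Injective q) (hq0 : ∀ μ, q μ ≠ 0)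
    (hrank : A.rank = A₀.rank) (hmult : ∀ μ, eigenMult A (q μ) = eigenMult A₀ μ) :
    A ∈ singularStratum m n A₀.rank (posSpectrum A₀).card
      (∑ μ ∈ posSpectrum A₀, eigenMult A₀ μ ^ 2) := by
  have himage : Finset.univ.image q = posSpectrum A := by
    refine image_univ_eq_of_sum_eq hq (fun μ => ?_) (fun x hx => (mem_posSpectrum_iff.mp hx).2) ?_
    · exact mem_posSpectrum_iff.mpr ⟨hq0 μ, hmult μ ▸ (mem_posSpectrum_iff.mp μ.2).2⟩
    · simp only [hmult, sum_coe_eigenMult, sum_eigenMult, hrank]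
  refine ⟨hrank, ?_, ?_⟩
  · rw [← himage, Finset.card_image_of_injective _ hq, Finset.card_univ, Fintype.card_coe]
  · rw [← himage, Finset.sum_image hq.injOn]
    simp only [hmult]
    exact Finset.sum_coe_sort _ fun μ => eigenMult A₀ μ ^ 2

theorem eventually_mem_singularStratum_iff {V : Matrix (Fin n) (Fin n) ℂ} {d : Fin n → ℝ}
    {U : Matrix (Fin m) (Fin m) ℂ} {e : Fin m → ℝ}
    (hV : IsUnitaryDiagonalization (A₀ᴴ * A₀) V d)
    (hU : IsUnitaryDiagonalization (A₀ * A₀ᴴ) U e) :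
    ∀ᶠ ε in 𝓝[>] (0 : ℝ), ∀ᶠ A in 𝓝 A₀,
      A ∈ singularStratum m n A₀.rank (posSpectrum A₀).card
          (∑ μ ∈ posSpectrum A₀, eigenMult A₀ μ ^ 2) ↔
        ∃ q : posSpectrum A₀ → ℝ, dist q (↑) < ε ∧
          stratumEquation A₀ V d U e (posSpectrum A₀) (A, q) = 0 := by
  obtain ⟨δ, hδ, hdet⟩ := Metric.eventually_nhds_iff.mp
    (eventually_det_one_add_shiftedPinv_mul_shiftDiff_ne_zero A₀ V d (posSpectrum A₀))
  filter_upwards [eventually_separated (posSpectrum A₀), eventually_lt_posSpectrum A₀,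
    Ioo_mem_nhdsGT hδ] with ε hsep hpos ⟨hε, hεδ⟩
  filter_upwards [eventually_exists_posSpectrum_near A₀ hε hpos, Metric.ball_mem_nhds A₀ hε,
    eventually_det_one_add_mul_sub_ne_zero A₀ (shiftedPinv V d 0 * A₀ᴴ)] with A hnear hA hdet₀
  replace hdet {q : posSpectrum A₀ → ℝ} (hq : dist q (↑) < ε) (μ : posSpectrum A₀) :
      (1 + shiftedPinv V d μ * shiftDiff A₀ μ A (q μ)).det ≠ 0 :=
    hdet (y := (A, q)) ((max_lt hA hq).trans hεδ) μ
  have hinj {q : posSpectrum A₀ → ℝ} (hq : dist q (↑) < ε) : Function.Injective q := by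
    intro μ ν hμν
    rw [dist_pi_lt_iff hε] at hq
    exact Subtype.ext (hsep μ μ.2 ν ν.2 (q μ) (hq μ) (hμν ▸ hq ν))
  constructor
  · rintro ⟨hrank, hcard, -⟩
    choose! f hf hdist using hnear
    let q : posSpectrum A₀ → ℝ := fun μ => f μ
    have hq : dist q (↑) < ε := (dist_pi_lt_iff hε).mpr fun μ => hdist μ μ.2
    refine ⟨q, hq, (stratumEquation_eq_zero_iff hV hU hdet₀ (hdet hq)).mpr ⟨hrank, ?_⟩⟩
    exact eigenMult_eq_of_le_of_rank_eq (hinj hq) (fun μ => hf μ μ.2)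
      (fun μ => eigenMult_le_of_det_ne_zero hV (hdet hq μ)) hrank hcard
  · rintro ⟨q, hq, hzero⟩
    obtain ⟨hrank, hmult⟩ := (stratumEquation_eq_zero_iff hV hU hdet₀ (hdet hq)).mp hzero
    refine mem_singularStratum_of_eigenMult_eq (hinj hq) (fun μ hμ => ?_) hrank hmult
    have hdist := (dist_pi_lt_iff hε).mp hq μ
    rw [hμ, Real.dist_eq, zero_sub, abs_neg] at hdist
    exact (hpos μ μ.2).not_ge ((le_abs_self _).trans hdist.le)

open scoped ComplexOrder in
theorem finrank_stratumEquation_codomain {V : Matrix (Fin n) (Fin n) ℂ} {d : Fin n → ℝ}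
    {U : Matrix (Fin m) (Fin m) ℂ} {e : Fin m → ℝ}
    (hV : IsUnitaryDiagonalization (A₀ᴴ * A₀) V d)
    (hU : IsUnitaryDiagonalization (A₀ * A₀ᴴ) U e) (s : Finset ℝ) :
    Module.finrank ℝ (((μ : s) → selfAdjoint (Matrix {j // d j = μ} {j // d j = μ} ℂ)) ×
        Matrix {i // e i = 0} {j // d j = 0} ℂ) =
      ∑ μ ∈ s, eigenMult A₀ μ ^ 2 + 2 * ((m - A₀.rank) * (n - A₀.rank)) := by
  replace hU : IsUnitaryDiagonalization (A₀ᴴᴴ * A₀ᴴ) U e := by rwa [conjTranspose_conjTranspose]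
  have hker := rank_add_eigenMult_zero A₀
  have hcoker := rank_add_eigenMult_zero A₀ᴴ
  rw [rank_conjTranspose] at hcoker
  rw [Module.finrank_prod, Module.finrank_pi_fintype, finrank_real_matrix]
  simp only [finrank_selfAdjoint_matrix, ← hV.eigenMult_eq_card, ← hU.eigenMult_eq_card]
  rw [Finset.sum_coe_sort s fun μ => eigenMult A₀ μ ^ 2, ← Nat.eq_sub_of_add_eq' hker,
    ← Nat.eq_sub_of_add_eq' hcoker]

theorem hasSliceChartAt_singularStratum (A₀ : Matrix (Fin m) (Fin n) ℂ) {k : ℕ}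
    (hk : k + (∑ μ ∈ posSpectrum A₀, eigenMult A₀ μ ^ 2 + 2 * ((m - A₀.rank) * (n - A₀.rank)))
      = 2 * (m * n) + (posSpectrum A₀).card) :
    HasSliceChartAt k (singularStratum m n A₀.rank (posSpectrum A₀).card
      (∑ μ ∈ posSpectrum A₀, eigenMult A₀ μ ^ 2)) A₀ := by
  let d : Fin n → ℝ := fun j => matrixSingularValue A₀ j ^ 2
  let e : Fin m → ℝ := fun i => matrixSingularValue A₀ᴴ i ^ 2
  obtain ⟨V, hV⟩ : ∃ V, IsUnitaryDiagonalization (A₀ᴴ * A₀) V d :=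
    exists_isUnitaryDiagonalization_conjTranspose_mul_self A₀
  obtain ⟨U, hU⟩ : ∃ U, IsUnitaryDiagonalization (A₀ * A₀ᴴ) U e :=
    exists_isUnitaryDiagonalization_mul_conjTranspose_self A₀
  refine hasSliceChartAt_of_parametric_submersion
    (contDiff_stratumEquation A₀ V d U e (posSpectrum A₀)).contDiffAt
    (stratumEquation_self A₀ V d U e (posSpectrum A₀)) ?_ ?_
    (eventually_mem_singularStratum_iff hV hU) ?_
  · exact fun ⟨B, C⟩ => ⟨_, fderiv_stratumEquation_preimage C hV hU
      (fun μ hμ => (mem_posSpectrum_iff.mp hμ).1) B⟩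
  · exact fun w => eq_zero_of_fderiv_stratumEquation_eq_zero hV
      fun μ hμ => eigenMult_pos_iff.mp (mem_posSpectrum_iff.mp hμ).2
  · rw [finrank_stratumEquation_codomain hV hU, hk,
      finrank_real_matrix, Module.finrank_fintype_fun_eq_card]
    simp only [Fintype.card_fin, Fintype.card_coe]

theorem isSmoothSubmanifold_singularStratum {ρ r c k : ℕ}
    (hk : k + (c + 2 * ((m - ρ) * (n - ρ))) = 2 * (m * n) + r) :
    IsSmoothSubmanifold k (singularStratum m n ρ r c) := by
  rintro A₀ ⟨rfl, rfl, rfl⟩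
  exact hasSliceChartAt_singularStratum A₀ hk

end StrataSubmanifold

section SingularValueDecomposition

variable {m n : ℕ}

theorem matrixSingularValue_nonneg (A : Matrix (Fin m) (Fin n) ℂ) (i : ℕ) :
    0 ≤ matrixSingularValue A i :=
  LinearMap.singularValues_nonneg _ i

theorem matrixSingularValue_pos_iff (A : Matrix (Fin m) (Fin n) ℂ) (i : ℕ) :
    0 < matrixSingularValue A i ↔ i < A.rank := by
  rw [matrixSingularValue, LinearMap.singularValues_pos_iff_lt_finrank_range,
    Matrix.rank_eq_finrank_range_toLin A (EuclideanSpace.basisFun (Fin m) ℂ).toBasis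
      (EuclideanSpace.basisFun (Fin n) ℂ).toBasis, Matrix.toEuclideanLin_eq_toLin_orthonormal]

theorem matrixSingularValue_eq_zero_iff (A : Matrix (Fin m) (Fin n) ℂ) (i : ℕ) :
    matrixSingularValue A i = 0 ↔ A.rank ≤ i := by
  rw [← not_lt, ← matrixSingularValue_pos_iff, not_lt]
  exact (matrixSingularValue_nonneg A i).ge_iff_eq'.symm

theorem rank_le_min (A : Matrix (Fin m) (Fin n) ℂ) : A.rank ≤ min m n :=
  le_min A.rank_le_height A.rank_le_width

/-- The rectangular matrix with the entries of `τ` on its main diagonal and zeros elsewhere. -/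
def rectDiagonal (m n : ℕ) (τ : ℕ → ℝ) : Matrix (Fin m) (Fin n) ℂ :=
  Matrix.of fun i j => if (i : ℕ) = j then (τ j : ℂ) else 0

theorem mul_rectDiagonal_apply {ι : Type*} (U : Matrix ι (Fin m) ℂ) (τ : ℕ → ℝ) (i : ι)
    (j : Fin n) :
    (U * rectDiagonal m n τ) i j = if h : (j : ℕ) < m then U i ⟨j, h⟩ * (τ j : ℂ) else 0 := by
  rw [Matrix.mul_apply]
  split_ifs with h
  · rw [Finset.sum_eq_single ⟨j, h⟩]
    · simp [rectDiagonal]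
    · intro k _ hk
      simp [rectDiagonal, mt (@Fin.ext _ k ⟨j, h⟩) hk]
    · simp
  · refine Finset.sum_eq_zero fun k _ => ?_
    have hkj : (k : ℕ) ≠ j := fun hkj => h (hkj ▸ k.2)
    simp [rectDiagonal, hkj]

theorem rectDiagonal_conjTranspose_mul_self (m n : ℕ) (τ : ℕ → ℝ) :
    (rectDiagonal m n τ)ᴴ * rectDiagonal m n τ =
      diagonal fun j : Fin n => ((if (j : ℕ) < m then τ j ^ 2 else 0 : ℝ) : ℂ) := by
  ext i j
  rw [mul_rectDiagonal_apply]
  obtain rfl | hij := eq_or_ne i j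
  · by_cases hi : (i : ℕ) < m <;> simp [rectDiagonal, hi, sq]
  · simp [rectDiagonal, hij, Fin.val_ne_of_ne hij.symm]

theorem isUnitaryDiagonalization_gram_rectDiagonal {U : Matrix (Fin m) (Fin m) ℂ}
    {V : Matrix (Fin n) (Fin n) ℂ} (hU : Uᴴ * U = 1) (hV : Vᴴ * V = 1) (τ : ℕ → ℝ) :
    IsUnitaryDiagonalization ((U * rectDiagonal m n τ * Vᴴ)ᴴ * (U * rectDiagonal m n τ * Vᴴ)) V
      fun j => if (j : ℕ) < m then τ j ^ 2 else 0 := by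
  refine ⟨hV, ?_⟩
  calc (U * rectDiagonal m n τ * Vᴴ)ᴴ * (U * rectDiagonal m n τ * Vᴴ)
      = V * ((rectDiagonal m n τ)ᴴ * (Uᴴ * U * rectDiagonal m n τ)) * Vᴴ := by
        simp only [conjTranspose_mul, conjTranspose_conjTranspose, Matrix.mul_assoc]
    _ = V * ((rectDiagonal m n τ)ᴴ * rectDiagonal m n τ) * Vᴴ := by rw [hU, Matrix.one_mul]
    _ = _ := congr(V * $(rectDiagonal_conjTranspose_mul_self m n τ) * Vᴴ)

theorem orthonormal_inv_smul_col {m n : Type*} [Fintype m] [DecidableEq n] {W : Matrix m n ℂ}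
    {s : n → ℝ} (hW : Wᴴ * W = diagonal fun j => ((s j ^ 2 : ℝ) : ℂ)) :
    Orthonormal ℂ fun j : {j // s j ≠ 0} => (s j : ℂ)⁻¹ • WithLp.toLp 2 (W.col j) := by
  rw [orthonormal_iff_ite]
  intro i j
  have hinner : inner ℂ (WithLp.toLp 2 (W.col i)) (WithLp.toLp 2 (W.col j)) = (Wᴴ * W) i j := by
    simp [PiLp.inner_apply, Matrix.mul_apply, mul_comm]
  rw [inner_smul_left, inner_smul_right, hinner, hW]
  obtain rfl | hij := eq_or_ne i j
  · have hi : (s i : ℂ) ≠ 0 := Complex.ofReal_ne_zero.mpr i.2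
    simp [sq, hi]
  · simp [hij, Subtype.coe_ne_coe.mpr hij]

open scoped ComplexOrder in
theorem apply_eq_zero_of_conjTranspose_mul_self_apply_eq_zero {m n : Type*} [Fintype m]
    {W : Matrix m n ℂ} {j : n} (hW : (Wᴴ * W) j j = 0) (i : m) : W i j = 0 :=
  congrFun ((dotProduct_star_self_eq_zero (v := W.col j)).mp hW) i

theorem exists_eq_mul_rectDiagonal {W : Matrix (Fin m) (Fin n) ℂ} {s : ℕ → ℝ}
    (hs : ∀ j, m ≤ j → s j = 0) (hW : Wᴴ * W = diagonal fun j : Fin n => ((s j ^ 2 : ℝ) : ℂ)) :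
    ∃ U : Matrix (Fin m) (Fin m) ℂ, Uᴴ * U = 1 ∧ W = U * rectDiagonal m n s := by
  let u : Fin m → EuclideanSpace ℂ (Fin m) := fun i =>
    if h : (i : ℕ) < n then (s i : ℂ)⁻¹ • WithLp.toLp 2 (W.col ⟨i, h⟩) else 0
  let S : Set (Fin m) := {i | (i : ℕ) < n ∧ s i ≠ 0}
  have hu : Orthonormal ℂ (S.domRestrict u) := by
    convert (orthonormal_inv_smul_col hW).comp
      (fun i : S => (⟨⟨i, i.2.1⟩, i.2.2⟩ : {j : Fin n // s j ≠ 0})) ?_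
    · exact funext fun i => dif_pos i.2.1
    · intro i i' h
      simpa [Subtype.ext_iff, Fin.ext_iff] using h
  obtain ⟨b, hb⟩ := hu.exists_orthonormalBasis_extension_of_card_eq (by simp)
  refine ⟨Matrix.of fun i j => b j i, conjTranspose_mul_self_of_orthonormalBasis b, ?_⟩
  ext i j
  rw [mul_rectDiagonal_apply]
  obtain hj | hj := eq_or_ne (s j) 0
  · have hWj : W i j = 0 :=
      apply_eq_zero_of_conjTranspose_mul_self_apply_eq_zero (by simp [hW, hj]) i
    simp [hj, hWj]
  · have hjm : (j : ℕ) < m := not_le.mp fun h => hj (hs j h)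
    have hsj : (s j : ℂ) ≠ 0 := Complex.ofReal_ne_zero.mpr hj
    simp [hjm, hb ⟨j, hjm⟩ ⟨j.2, hj⟩, u, mul_comm, hsj]

theorem exists_singular_value_decomposition (A : Matrix (Fin m) (Fin n) ℂ) :
    ∃ (U : Matrix (Fin m) (Fin m) ℂ) (V : Matrix (Fin n) (Fin n) ℂ), Uᴴ * U = 1 ∧ Vᴴ * V = 1 ∧
      A = U * rectDiagonal m n (matrixSingularValue A) * Vᴴ := by
  obtain ⟨V, hV⟩ := exists_isUnitaryDiagonalization_conjTranspose_mul_self A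
  have hgram : (A * V)ᴴ * (A * V) =
      diagonal fun j : Fin n => ((matrixSingularValue A j ^ 2 : ℝ) : ℂ) := by
    calc (A * V)ᴴ * (A * V) = Vᴴ * (Aᴴ * A) * V := by
          simp only [conjTranspose_mul, Matrix.mul_assoc]
      _ = Vᴴ * V * diagonal (fun j : Fin n => ((matrixSingularValue A j ^ 2 : ℝ) : ℂ)) *
          (Vᴴ * V) := by
        rw [hV.eq_conj_diagonal]
        simp only [Matrix.mul_assoc]
        rfl
      _ = _ := by rw [hV.conjTranspose_mul_self, Matrix.one_mul, Matrix.mul_one]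
  obtain ⟨U, hU, hAV⟩ := exists_eq_mul_rectDiagonal
    (fun j hj => (matrixSingularValue_eq_zero_iff A j).mpr (A.rank_le_height.trans hj)) hgram
  refine ⟨U, V, hU, hV.conjTranspose_mul_self, ?_⟩
  rw [← hAV, Matrix.mul_assoc, hV.mul_conjTranspose_self, Matrix.mul_one]

end SingularValueDecomposition

section RepeatedSingularValues

variable {m n : ℕ} {A : Matrix (Fin m) (Fin n) ℂ}

theorem posSpectrum_eq_image (A : Matrix (Fin m) (Fin n) ℂ) :
    posSpectrum A = (Finset.range A.rank).image fun i => matrixSingularValue A i ^ 2 := by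
  ext μ
  simp only [posSpectrum, Finset.mem_erase, Finset.mem_image, Finset.mem_univ, true_and,
    Finset.mem_range, ← matrixSingularValue_pos_iff]
  constructor
  · rintro ⟨hne, j, rfl⟩
    exact ⟨j, (matrixSingularValue_nonneg A j).lt_of_ne' (ne_zero_pow two_ne_zero hne), rfl⟩
  · rintro ⟨i, hi, rfl⟩
    have hin : i < n := ((matrixSingularValue_pos_iff A i).mp hi).trans_le A.rank_le_width
    exact ⟨(pow_pos hi 2).ne', ⟨i, hin⟩, rfl⟩

theorem card_posSpectrum_eq_rank_iff :
    (posSpectrum A).card = A.rank ↔ Set.InjOn (matrixSingularValue A) (Set.Iio A.rank) := by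
  have hsq (i j : ℕ) : matrixSingularValue A i ^ 2 = matrixSingularValue A j ^ 2 ↔
      matrixSingularValue A i = matrixSingularValue A j :=
    pow_left_inj₀ (matrixSingularValue_nonneg A i) (matrixSingularValue_nonneg A j) two_ne_zero
  rw [posSpectrum_eq_image]
  nth_rw 2 [← Finset.card_range A.rank]
  rw [Finset.card_image_iff, Finset.coe_range]
  simp only [Set.InjOn, hsq]

theorem notMem_repeatedSingularValueSet_iff :
    A ∉ repeatedSingularValueSet m n ↔
      Set.InjOn (matrixSingularValue A) (Set.Iio (min m n)) := by
  constructor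
  · intro h i hi j hj hij
    by_contra hne
    rcases lt_or_gt_of_ne hne with hlt | hlt
    · exact h ⟨i, j, hlt, hj, hij⟩
    · exact h ⟨j, i, hlt, hi, hij.symm⟩
  · rintro hinj ⟨i, j, hij, hj, heq⟩
    exact hij.ne (hinj (hij.trans hj) hj heq)

theorem injOn_matrixSingularValue_Iio_min_iff :
    Set.InjOn (matrixSingularValue A) (Set.Iio (min m n)) ↔
      Set.InjOn (matrixSingularValue A) (Set.Iio A.rank) ∧ min m n ≤ A.rank + 1 := by
  constructor
  · intro hinj
    refine ⟨hinj.mono (Set.Iio_subset_Iio (rank_le_min A)), not_lt.mp fun hlt => ?_⟩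
    have heq : matrixSingularValue A A.rank = matrixSingularValue A (A.rank + 1) := by
      rw [(matrixSingularValue_eq_zero_iff A _).mpr le_rfl,
        (matrixSingularValue_eq_zero_iff A _).mpr A.rank.le_succ]
    exact A.rank.succ_ne_self (hinj (A.rank.lt_succ_self.trans hlt) hlt heq).symm
  · rintro ⟨hinj, hle⟩ i hi j hj hij
    have hiff : i < A.rank ↔ j < A.rank := by
      rw [← matrixSingularValue_pos_iff, hij, matrixSingularValue_pos_iff]
    by_cases hjr : j < A.rank
    · exact hinj (hiff.mpr hjr) hjr hij
    · rw [Set.mem_Iio] at hi hj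
      lia

theorem mem_repeatedSingularValueSet_iff :
    A ∈ repeatedSingularValueSet m n ↔
      ¬((posSpectrum A).card = A.rank ∧ min m n ≤ A.rank + 1) := by
  rw [card_posSpectrum_eq_rank_iff, ← injOn_matrixSingularValue_Iio_min_iff,
    ← notMem_repeatedSingularValueSet_iff, not_not]

/-- The matrices of full rank all of whose singular values are simple, except for one of
multiplicity `2`: the square sum of the multiplicities is `(min m n - 2) * 1 ^ 2 + 2 ^ 2`. -/
def simplyRepeatedStratum (m n : ℕ) : Set (Matrix (Fin m) (Fin n) ℂ) :=
  singularStratum m n (min m n) (min m n - 1) (min m n + 2)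

theorem sum_sq_eq_card_add_three {ι : Type*} {s : Finset ι} {f : ι → ℕ} (hf : ∀ i ∈ s, 0 < f i)
    (hsum : ∑ i ∈ s, f i = s.card + 1) : ∑ i ∈ s, f i ^ 2 = s.card + 3 := by
  have hexcess : ∑ i ∈ s, (f i - 1) = 1 := by
    rw [Finset.sum_tsub_distrib s hf, hsum, ← Finset.card_eq_sum_ones, Nat.add_sub_cancel_left]
  have hsq : ∀ i ∈ s, f i ^ 2 = 1 + 3 * (f i - 1) := by
    intro i hi
    have hle : f i - 1 ≤ 1 := hexcess ▸
      Finset.single_le_sum (f := fun i => f i - 1) (fun _ _ => Nat.zero_le _) hi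
    obtain h | h : f i = 1 ∨ f i = 2 := by have := hf i hi; lia
    all_goals simp [h]
  rw [Finset.sum_congr rfl hsq, Finset.sum_add_distrib, ← Finset.mul_sum, hexcess,
    ← Finset.card_eq_sum_ones, mul_one]

theorem mem_simplyRepeatedStratum_iff (hp : 0 < min m n) :
    A ∈ simplyRepeatedStratum m n ↔
      A.rank = min m n ∧ (posSpectrum A).card = min m n - 1 := by
  refine ⟨fun h => ⟨h.1, h.2.1⟩, fun ⟨hrank, hcard⟩ => ⟨hrank, hcard, ?_⟩⟩
  rw [sum_sq_eq_card_add_three (fun μ hμ => (mem_posSpectrum_iff.mp hμ).2), hcard]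
  · lia
  · rw [sum_eigenMult]
    lia

theorem simplyRepeatedStratum_eq_inter (hp : 0 < min m n) :
    simplyRepeatedStratum m n = repeatedSingularValueSet m n ∩
      {A | min m n ≤ A.rank ∧ min m n - 1 ≤ (posSpectrum A).card} := by
  ext A
  have hrank := rank_le_min A
  have hcard := card_posSpectrum_le_rank A
  rw [mem_simplyRepeatedStratum_iff hp, Set.mem_inter_iff, mem_repeatedSingularValueSet_iff,
    Set.mem_ofPred_eq]
  lia

theorem isOpen_setOf_le_rank_and_le_card_posSpectrum (a b : ℕ) :
    IsOpen {A : Matrix (Fin m) (Fin n) ℂ | a ≤ A.rank ∧ b ≤ (posSpectrum A).card} := by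
  rw [isOpen_iff_mem_nhds]
  rintro A₀ ⟨ha, hb⟩
  filter_upwards [eventually_rank_le A₀, eventually_card_posSpectrum_le A₀] with A hrank hcard
  exact ⟨ha.trans hrank, hb.trans hcard⟩

theorem zero_mem_repeatedSingularValueSet (hp : 2 ≤ min m n) :
    (0 : Matrix (Fin m) (Fin n) ℂ) ∈ repeatedSingularValueSet m n := by
  rw [mem_repeatedSingularValueSet_iff, Matrix.rank_zero]
  lia

theorem isSmoothSubmanifold_simplyRepeatedStratum (hp : 2 ≤ min m n) :
    IsSmoothSubmanifold (2 * (m * n) - 3) (simplyRepeatedStratum m n) := by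
  have hmn : 2 * 2 ≤ m * n := Nat.mul_le_mul (le_min_iff.mp hp).1 (le_min_iff.mp hp).2
  have hcorank : (m - min m n) * (n - min m n) = 0 := by
    rcases min_choice m n with h | h <;> simp [h]
  refine isSmoothSubmanifold_singularStratum ?_
  rw [hcorank]
  lia

end RepeatedSingularValues

section Density

variable {m n : ℕ} {U : Matrix (Fin m) (Fin m) ℂ} {V : Matrix (Fin n) (Fin n) ℂ} {τ : ℕ → ℝ}

theorem rank_mul_rectDiagonal_mul (hU : Uᴴ * U = 1) (hV : Vᴴ * V = 1)
    (hτ : ∀ i < min m n, 0 < τ i) : (U * rectDiagonal m n τ * Vᴴ).rank = min m n := by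
  have hnull : ∀ j : Fin n, (if (j : ℕ) < m then τ j ^ 2 else 0) = 0 ↔ ¬(j : ℕ) < m := by
    intro j
    split_ifs with h
    · simpa [h] using (hτ j (lt_min h j.2)).ne'
    · simp [h]
  have hker : eigenMult (U * rectDiagonal m n τ * Vᴴ) 0 = n - min m n := by
    rw [(isUnitaryDiagonalization_gram_rectDiagonal hU hV τ).eigenMult_eq_card]
    simp only [hnull]
    rw [Fintype.card_subtype_compl, Fintype.card_fin, Fintype.card_subtype,
      Fin.card_filter_val_lt, min_comm]
  have hrank := rank_add_eigenMult_zero (U * rectDiagonal m n τ * Vᴴ)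
  lia

theorem posSpectrum_mul_rectDiagonal_mul (hU : Uᴴ * U = 1) (hV : Vᴴ * V = 1)
    (hτ : ∀ i < min m n, 0 < τ i) :
    posSpectrum (U * rectDiagonal m n τ * Vᴴ) =
      (Finset.range (min m n)).image fun i => τ i ^ 2 := by
  ext μ
  rw [mem_posSpectrum_iff,
    (isUnitaryDiagonalization_gram_rectDiagonal hU hV τ).eigenMult_eq_card,
    Fintype.card_pos_iff, nonempty_subtype]
  simp only [Finset.mem_image, Finset.mem_range]
  constructor
  · rintro ⟨hμ, j, hj⟩
    obtain ⟨hjm, rfl⟩ : (j : ℕ) < m ∧ τ j ^ 2 = μ := by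
      split_ifs at hj with h
      · exact ⟨h, hj⟩
      · exact absurd hj.symm hμ
    exact ⟨j, lt_min hjm j.2, rfl⟩
  · rintro ⟨i, hi, rfl⟩
    obtain ⟨him, hin⟩ := lt_min_iff.mp hi
    exact ⟨(pow_pos (hτ i hi) 2).ne', ⟨i, hin⟩, if_pos him⟩

theorem mul_rectDiagonal_mul_mem_simplyRepeatedStratum (hU : Uᴴ * U = 1) (hV : Vᴴ * V = 1)
    (hτ : ∀ i < min m n, 0 < τ i) (hinj : Function.Injective τ) {a b : ℕ} (hab : a < b)
    (hb : b < min m n) :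
    U * rectDiagonal m n (τ ∘ Function.update id b a) * Vᴴ ∈ simplyRepeatedStratum m n := by
  have hpos : ∀ i < min m n, 0 < (τ ∘ Function.update id b a) i := by
    intro i hi
    refine hτ _ ?_
    obtain rfl | hib := eq_or_ne i b
    · simpa using hab.trans hb
    · simpa [hib] using hi
  have himage : (Finset.range (min m n)).image (Function.update id b a) =
      (Finset.range (min m n)).erase b := by
    ext i
    simp only [Finset.mem_image, Finset.mem_range, Finset.mem_erase, Function.update_apply, id]
    grind
  have hsq : Set.InjOn (fun i => τ i ^ 2) ((Finset.range (min m n)).erase b) := by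
    intro i hi j hj hij
    simp only [Finset.coe_erase, Finset.coe_range, Set.mem_sdiff, Set.mem_Iio] at hi hj
    exact hinj ((pow_left_inj₀ (hτ i hi.1).le (hτ j hj.1).le two_ne_zero).mp hij)
  refine (mem_simplyRepeatedStratum_iff (Nat.zero_lt_of_lt hb)).mpr
    ⟨rank_mul_rectDiagonal_mul hU hV hpos, ?_⟩
  rw [posSpectrum_mul_rectDiagonal_mul hU hV hpos]
  change ((Finset.range (min m n)).image ((fun i => τ i ^ 2) ∘ Function.update id b a)).card = _
  rw [← Finset.image_image, himage, Finset.card_image_of_injOn hsq,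
    Finset.card_erase_of_mem (Finset.mem_range.mpr hb), Finset.card_range]

theorem continuous_rectDiagonal {X : Type*} [TopologicalSpace X] {τ : X → ℕ → ℝ}
    (hτ : ∀ i, Continuous fun x => τ x i) : Continuous fun x => rectDiagonal m n (τ x) := by
  refine continuous_matrix fun i j => ?_
  by_cases hij : (i : ℕ) = j
  · simpa [rectDiagonal, hij, Function.comp_def] using Complex.continuous_ofReal.comp (hτ j)
  · simpa [rectDiagonal, hij] using continuous_const

theorem repeatedSingularValueSet_subset_closure :
    repeatedSingularValueSet m n ⊆ closure (simplyRepeatedStratum m n) := by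
  rintro A ⟨a, b, hab, hb, hσ⟩
  obtain ⟨U, V, hU, hV, hA⟩ := exists_singular_value_decomposition A
  let σ : ℝ → ℕ → ℝ := fun t i => matrixSingularValue A i + t * ((min m n : ℕ) - i)
  let f : ℝ → Matrix (Fin m) (Fin n) ℂ :=
    fun t => U * rectDiagonal m n (σ t ∘ Function.update id b a) * Vᴴ
  have hf : Continuous f := by
    have hrect : Continuous fun t => rectDiagonal m n (σ t ∘ Function.update id b a) :=
      continuous_rectDiagonal fun i => by fun_prop
    fun_prop
  have hf0 : f 0 = A := by
    have hσ0 : σ 0 ∘ Function.update id b a = matrixSingularValue A := by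
      funext i
      obtain rfl | hib := eq_or_ne i b
      · simp [σ, hσ]
      · simp [σ, hib]
    exact (congr(U * rectDiagonal m n ($hσ0) * Vᴴ)).trans hA.symm
  refine mem_closure_of_tendsto (f := f) (b := 𝓝[>] 0)
    (hf0 ▸ hf.continuousAt.mono_left nhdsWithin_le_nhds) ?_
  filter_upwards [eventually_mem_nhdsWithin] with t (ht : 0 < t)
  have hanti : StrictAnti (σ t) := by
    refine Antitone.add_strictAnti (LinearMap.singularValues_antitone _) fun i j hij => ?_
    gcongr
  refine mul_rectDiagonal_mul_mem_simplyRepeatedStratum hU hV (fun i hi => ?_) hanti.injective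
    hab hb
  have hgap : (0 : ℝ) < (min m n : ℕ) - i := sub_pos.mpr (Nat.cast_lt.mpr hi)
  exact add_pos_of_nonneg_of_pos (matrixSingularValue_nonneg A i) (mul_pos ht hgap)

end Density

section LowerStrata

theorem three_mul_sum_le_sum_sq_add {ι : Type*} (s : Finset ι) (f : ι → ℕ) :
    3 * ∑ i ∈ s, f i ≤ ∑ i ∈ s, f i ^ 2 + 2 * s.card := by
  rw [Finset.card_eq_sum_ones, Finset.mul_sum, Finset.mul_sum, ← Finset.sum_add_distrib]
  refine Finset.sum_le_sum fun i _ => ?_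
  obtain h | h : f i ≤ 1 ∨ 2 ≤ f i := by lia
  · interval_cases f i <;> simp
  · nlinarith

variable {m n : ℕ} {A : Matrix (Fin m) (Fin n) ℂ}

theorem sum_eigenMult_sq_le (A : Matrix (Fin m) (Fin n) ℂ) :
    ∑ μ ∈ posSpectrum A, eigenMult A μ ^ 2 ≤ A.rank ^ 2 := by
  rw [← sum_eigenMult A]
  exact Finset.sum_sq_le_sq_sum_of_nonneg fun _ _ => Nat.zero_le _

theorem sq_add_two_mul_sub_mul_sub_le {m n ρ : ℕ} (hm : ρ ≤ m) (hn : ρ ≤ n) :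
    ρ ^ 2 + 2 * ((m - ρ) * (n - ρ)) ≤ 2 * (m * n) := by
  obtain ⟨x, rfl⟩ := Nat.exists_eq_add_of_le hm
  obtain ⟨y, rfl⟩ := Nat.exists_eq_add_of_le hn
  rw [Nat.add_sub_cancel_left, Nat.add_sub_cancel_left]
  nlinarith

theorem add_four_le_codim {ρ r c : ℕ} (hρ : ρ ≤ min m n) (hr : r ≤ ρ) (hc : 3 * ρ ≤ c + 2 * r)
    (hrep : ¬(r = ρ ∧ min m n ≤ ρ + 1)) (hsimple : ¬(ρ = min m n ∧ r = min m n - 1)) :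
    r + 4 ≤ c + 2 * ((m - ρ) * (n - ρ)) := by
  obtain h | h | h : ρ + 2 ≤ min m n ∨ ρ + 1 = min m n ∨ ρ = min m n := by lia
  · have hcorank : 2 * 2 ≤ (m - ρ) * (n - ρ) := Nat.mul_le_mul (by lia) (by lia)
    lia
  · have hcorank : 1 * 1 ≤ (m - ρ) * (n - ρ) := Nat.mul_le_mul (by lia) (by lia)
    lia
  · lia

theorem mem_repeatedSingularValueSet_sdiff_iff (hp : 0 < min m n) :
    A ∈ repeatedSingularValueSet m n \ simplyRepeatedStratum m n ↔
      ¬((posSpectrum A).card = A.rank ∧ min m n ≤ A.rank + 1) ∧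
        ¬(A.rank = min m n ∧ (posSpectrum A).card = min m n - 1) := by
  rw [Set.mem_sdiff, mem_repeatedSingularValueSet_iff, mem_simplyRepeatedStratum_iff hp]

theorem exists_isSmoothSubmanifold_singularStratum (hp : 0 < min m n)
    (hA : A ∈ repeatedSingularValueSet m n \ simplyRepeatedStratum m n) :
    ∃ k < 2 * (m * n) - 3, IsSmoothSubmanifold k (singularStratum m n A.rank (posSpectrum A).card
      (∑ μ ∈ posSpectrum A, eigenMult A μ ^ 2)) := by
  obtain ⟨hrep, hsimple⟩ := (mem_repeatedSingularValueSet_sdiff_iff hp).mp hA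
  have hsum := three_mul_sum_le_sum_sq_add (posSpectrum A) (eigenMult A)
  rw [sum_eigenMult] at hsum
  have hcodim := add_four_le_codim (rank_le_min A) (card_posSpectrum_le_rank A) hsum hrep hsimple
  have hsq := sum_eigenMult_sq_le A
  have hdim := sq_add_two_mul_sub_mul_sub_le A.rank_le_height A.rank_le_width
  obtain ⟨k, hk⟩ := Nat.exists_eq_add_of_le' (show
    ∑ μ ∈ posSpectrum A, eigenMult A μ ^ 2 + 2 * ((m - A.rank) * (n - A.rank)) ≤
      2 * (m * n) + (posSpectrum A).card by lia)
  exact ⟨k, by lia, isSmoothSubmanifold_singularStratum hk.symm⟩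

/-- The parameters `(ρ, r, c)` of the stratum `singularStratum m n ρ r c` that contains `A`. -/
noncomputable def singularType (A : Matrix (Fin m) (Fin n) ℂ) : ℕ × ℕ × ℕ :=
  (A.rank, (posSpectrum A).card, ∑ μ ∈ posSpectrum A, eigenMult A μ ^ 2)

theorem finite_range_singularType (m n : ℕ) :
    (Set.range (singularType : Matrix (Fin m) (Fin n) ℂ → ℕ × ℕ × ℕ)).Finite := by
  refine (Set.finite_Iic (min m n, min m n, min m n ^ 2)).subset ?_
  rintro _ ⟨A, rfl⟩
  exact ⟨rank_le_min A, (card_posSpectrum_le_rank A).trans (rank_le_min A),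
    (sum_eigenMult_sq_le A).trans (Nat.pow_le_pow_left (rank_le_min A) 2)⟩

theorem repeatedSingularValueSet_sdiff_eq_iUnion (hp : 0 < min m n) :
    repeatedSingularValueSet m n \ simplyRepeatedStratum m n =
      ⋃ t ∈ singularType '' (repeatedSingularValueSet m n \ simplyRepeatedStratum m n),
        singularStratum m n t.1 t.2.1 t.2.2 := by
  rw [Set.biUnion_image]
  refine Set.Subset.antisymm (fun A hA => Set.mem_biUnion hA ⟨rfl, rfl, rfl⟩)
    (Set.iUnion₂_subset fun A hA B ⟨hrank, hcard, _⟩ => ?_)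
  rw [mem_repeatedSingularValueSet_sdiff_iff hp] at hA ⊢
  rwa [hrank, hcard]

theorem exists_fin_iUnion_isSmoothSubmanifold {E ι : Type*} [NormedAddCommGroup E]
    [NormedSpace ℝ E] {I : Set ι} (hI : I.Finite) {T : ι → Set E} {d : ℕ}
    (hT : ∀ t ∈ I, ∃ e < d, IsSmoothSubmanifold e (T t)) :
    ∃ (k : ℕ) (T' : Fin k → Set E) (e : Fin k → ℕ),
      ⋃ t ∈ I, T t = ⋃ i, T' i ∧ ∀ i, e i < d ∧ IsSmoothSubmanifold (e i) (T' i) := by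
  obtain ⟨k, g, hg⟩ := hI.fin_embedding
  choose e he using fun i => hT (g i) (hg ▸ Set.mem_range_self i)
  exact ⟨k, T ∘ g, e, by rw [← hg, Set.biUnion_range]; rfl, he⟩

end LowerStrata

theorem mainTheorem3 (m n : ℕ) (hm : 2 ≤ m) (hn : 2 ≤ n) :
    HasRealCodimension (repeatedSingularValueSet m n) 3 := by
  have hp : 2 ≤ min m n := le_min hm hn
  have hp₀ : 0 < min m n := zero_lt_two.trans_le hp
  have hmn : 2 * 2 ≤ m * n := Nat.mul_le_mul hm hn
  refine ⟨⟨0, zero_mem_repeatedSingularValueSet hp⟩, 2 * (m * n) - 3, simplyRepeatedStratum m n,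
    ?_, isSmoothSubmanifold_simplyRepeatedStratum hp,
    ⟨_, isOpen_setOf_le_rank_and_le_card_posSpectrum _ _, simplyRepeatedStratum_eq_inter hp₀⟩,
    repeatedSingularValueSet_subset_closure, ?_⟩
  · rw [finrank_real_matrix, Fintype.card_fin, Fintype.card_fin]
    lia
  · rw [repeatedSingularValueSet_sdiff_eq_iUnion hp₀]
    refine exists_fin_iUnion_isSmoothSubmanifold
      ((finite_range_singularType m n).subset (Set.image_subset_range _ _)) ?_
    rintro _ ⟨A, hA, rfl⟩
    exact exists_isSmoothSubmanifold_singularStratum hp₀ hA
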